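/- Let $C$ be any ordinary category with pullbacks, and fix any choice of a pullback square for every cospan of $C$. *The bicategory of spans.* Let $2\mathrm{Span}(C)$ be the bicategory whose objects are the objects of $C$, whose 1-cells from $X$ to $Y$ are span diagrams $X\leftarrow S\rightarrow Y$ in $C$, and whose 2-cells are isomorphisms of span diagrams (isomorphisms $S\cong S'$ compatible with the maps to $X$ and $Y$). The composite of $X\leftarrow S\to Y$ and $Y\leftarrow T\to Z$ is formed with the chosen pullback $S\times_Y T$; identity 1-cells are the identity spans. *The nerve.* For a bicategory $B$ with all 2-cells invertible, an $n$-cell of the nerve $N(B)$ consists of objects $X_0,\dots,X_n$, 1-cells $f_{ij}:X_i\to X_j$ for $i<j$, and 2-cells $\theta_{ijk}:f_{jk}\circ f_{ij}\Rightarrow f_{ik}$ for $i<j<k$, such that for all $i<j<k<l$ the identity $\theta_{ijl}\circ(\theta_{jkl}*\mathrm{id}_{f_{ij}})=\theta_{ikl}\circ(\mathrm{id}_{f_{kl}}*\theta_{ijk})$ holds modulo the associator of $B$. The simplicial structure is given by reindexing, where by convention $f_{ii}$ is the identity 1-cell and $\theta_{iij}$, $\theta_{ijj}$ are the unitors. *The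 simplicial set of spans.* Let $C_n$ be the poset of nonempty subintervals of $[n]=\{0,\dots,n\}$, ordered by reverse inclusion; a monotone map $\alpha$ acts by sending the interval from $i$ to $j$ to the interval from $\alpha(i)$ to $\alpha(j)$. Let $\mathrm{Span}(C)$ be the simplicial set whose $n$-cells are the functors $F:C_n\to C$ such that, for any nonempty intervals $I,J$ in $[n]$ with nonempty intersection, the square with corners $F(I\cup J)$, $F(I)$, $F(J)$, $F(I\cap J)$ is a pullback square in $C$ (the pullback property); simplicial operators act by precomposition. Then: 1. there is an isomorphism of simplicial sets $N(2\mathrm{Span}(C))\cong\mathrm{Span}(C)$; 2. $\mathrm{Span}(C)$ is a $(2,1)$-category, that is, a quasicategory in which every inner horn $\Lambda^m_k\to\mathrm{Span}(C)$ with $m>2$ and $0<k<m$ has a unique extension to $\Delta^m$; 3. in particular, $\mathrm{Span}(C)$ is a quasicategory. -/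

import Mathlib

open CategoryTheory CategoryTheory.Limits CategoryTheory.Bicategory Simplicial Opposite

universe w v u

namespace SpanNerve

/-! ## The bicategory of spans -/

section TwoSpan

variable {C : Type u} [Category.{v} C]

variable (C) in
/-- A choice of a pullback square for every cospan of `C`. Such a choice is automatically
functorial in the cospan, by the universal property (see `PullbackChoice.mapIso` for the part of
this functoriality that is used here). -/
structure PullbackChoice where
  /-- the chosen pullback object -/
  obj {X Y Z : C} (f : X ⟶ Z) (g : Y ⟶ Z) : C
  /-- the first projection -/
  fst {X Y Z : C} (f : X ⟶ Z) (g : Y ⟶ Z) : obj f g ⟶ X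
  /-- the second projection -/
  snd {X Y Z : C} (f : X ⟶ Z) (g : Y ⟶ Z) : obj f g ⟶ Y
  isPullback {X Y Z : C} (f : X ⟶ Z) (g : Y ⟶ Z) : IsPullback (fst f g) (snd f g) f g

/-- A category with pullbacks admits a choice of pullbacks. -/
instance [HasPullbacks C] : Nonempty (PullbackChoice C) :=
  ⟨{ obj := fun f g => pullback f g
     fst := fun f g => pullback.fst f g
     snd := fun f g => pullback.snd f g
     isPullback := fun f g => IsPullback.of_hasPullback f g }⟩

namespace PullbackChoice

variable (P : PullbackChoice C)

lemma condition {X Y Z : C} (f : X ⟶ Z) (g : Y ⟶ Z) : P.fst f g ≫ f = P.snd f g ≫ g :=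
  (P.isPullback f g).w

lemma condition_assoc {W X Y Z : C} (f : X ⟶ Z) (g : Y ⟶ Z) (h : Z ⟶ W) :
    P.fst f g ≫ f ≫ h = P.snd f g ≫ g ≫ h := by
  rw [← Category.assoc, P.condition, Category.assoc]

/-- The morphism into the chosen pullback given by its universal property. -/
noncomputable def lift {W X Y Z : C} (f : X ⟶ Z) (g : Y ⟶ Z) (a : W ⟶ X) (b : W ⟶ Y)
    (h : a ≫ f = b ≫ g) : W ⟶ P.obj f g :=
  (P.isPullback f g).lift a b h

@[simp]
lemma lift_fst {W X Y Z : C} (f : X ⟶ Z) (g : Y ⟶ Z) (a : W ⟶ X) (b : W ⟶ Y)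
    (h : a ≫ f = b ≫ g) : P.lift f g a b h ≫ P.fst f g = a :=
  (P.isPullback f g).lift_fst a b h

@[simp]
lemma lift_fst_assoc {V W X Y Z : C} (f : X ⟶ Z) (g : Y ⟶ Z) (a : W ⟶ X) (b : W ⟶ Y)
    (h : a ≫ f = b ≫ g) (k : X ⟶ V) : P.lift f g a b h ≫ P.fst f g ≫ k = a ≫ k := by
  rw [← Category.assoc, P.lift_fst]

@[simp]
lemma lift_snd {W X Y Z : C} (f : X ⟶ Z) (g : Y ⟶ Z) (a : W ⟶ X) (b : W ⟶ Y)
    (h : a ≫ f = b ≫ g) : P.lift f g a b h ≫ P.snd f g = b :=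
  (P.isPullback f g).lift_snd a b h

@[simp]
lemma lift_snd_assoc {V W X Y Z : C} (f : X ⟶ Z) (g : Y ⟶ Z) (a : W ⟶ X) (b : W ⟶ Y)
    (h : a ≫ f = b ≫ g) (k : Y ⟶ V) : P.lift f g a b h ≫ P.snd f g ≫ k = b ≫ k := by
  rw [← Category.assoc, P.lift_snd]

lemma hom_ext {W X Y Z : C} {f : X ⟶ Z} {g : Y ⟶ Z} {a b : W ⟶ P.obj f g}
    (h₁ : a ≫ P.fst f g = b ≫ P.fst f g) (h₂ : a ≫ P.snd f g = b ≫ P.snd f g) : a = b :=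
  (P.isPullback f g).hom_ext h₁ h₂

/-- The isomorphism of chosen pullbacks induced by an isomorphism of cospans over a fixed
object. -/
@[simps]
noncomputable def mapIso {X X' Y Y' Z : C} {f : X ⟶ Z} {g : Y ⟶ Z} {f' : X' ⟶ Z} {g' : Y' ⟶ Z}
    (e : X ≅ X') (e' : Y ≅ Y') (h : e.hom ≫ f' = f) (h' : e'.hom ≫ g' = g) :
    P.obj f g ≅ P.obj f' g' where
  hom := P.lift _ _ (P.fst f g ≫ e.hom) (P.snd f g ≫ e'.hom) (by simp [h, h', P.condition])
  inv := P.lift _ _ (P.fst f' g' ≫ e.inv) (P.snd f' g' ≫ e'.inv)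
    (by simp [← h, ← h', P.condition])
  hom_inv_id := by apply P.hom_ext <;> simp
  inv_hom_id := by apply P.hom_ext <;> simp

/-- The comparison of the two ways of forming an iterated pullback. -/
@[simps]
noncomputable def assocIso {X Y A B D : C} (f : A ⟶ X) (g : B ⟶ X) (h : B ⟶ Y) (k : D ⟶ Y) :
    P.obj (P.snd f g ≫ h) k ≅ P.obj f (P.fst h k ≫ g) where
  hom := P.lift f (P.fst h k ≫ g) (P.fst (P.snd f g ≫ h) k ≫ P.fst f g)
    (P.lift h k (P.fst (P.snd f g ≫ h) k ≫ P.snd f g) (P.snd (P.snd f g ≫ h) k)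
      (by rw [Category.assoc, P.condition]))
    (by simp [P.condition])
  inv := P.lift (P.snd f g ≫ h) k
    (P.lift f g (P.fst f (P.fst h k ≫ g)) (P.snd f (P.fst h k ≫ g) ≫ P.fst h k)
      (by rw [Category.assoc, P.condition]))
    (P.snd f (P.fst h k ≫ g) ≫ P.snd h k)
    (by simp [P.condition])
  hom_inv_id := by
    apply P.hom_ext
    · apply P.hom_ext <;> simp
    · simp
  inv_hom_id := by
    apply P.hom_ext
    · simp
    · apply P.hom_ext <;> simp

/-- Pulling back along an identity, on the left. -/
@[simps]
noncomputable def leftUnitIso {X A : C} (f : A ⟶ X) : P.obj (𝟙 X) f ≅ A where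
  hom := P.snd (𝟙 X) f
  inv := P.lift (𝟙 X) f f (𝟙 A) (by simp)
  hom_inv_id := by
    apply P.hom_ext
    · simpa using (P.condition (𝟙 X) f).symm
    · simp
  inv_hom_id := by simp

/-- Pulling back along an identity, on the right. -/
@[simps]
noncomputable def rightUnitIso {X A : C} (f : A ⟶ X) : P.obj f (𝟙 X) ≅ A where
  hom := P.fst f (𝟙 X)
  inv := P.lift f (𝟙 X) (𝟙 A) f (by simp)
  hom_inv_id := by
    apply P.hom_ext
    · simp
    · simpa using P.condition f (𝟙 X)
  inv_hom_id := by simp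

end PullbackChoice

/-- A span diagram `X ⟵ apex ⟶ Y`. -/
structure SpanDiagram (X Y : C) where
  /-- the middle object -/
  apex : C
  /-- the left leg -/
  l : apex ⟶ X
  /-- the right leg -/
  r : apex ⟶ Y

/-- An isomorphism of span diagrams. -/
structure SpanDiagram.Hom {X Y : C} (S T : SpanDiagram X Y) where
  /-- the isomorphism of middle objects -/
  iso : S.apex ≅ T.apex
  hom_l : iso.hom ≫ T.l = S.l
  hom_r : iso.hom ≫ T.r = S.r

namespace SpanDiagram

attribute [simp] Hom.hom_l Hom.hom_r

@[simp]
lemma Hom.hom_l_assoc {X Y W : C} {S T : SpanDiagram X Y} (f : S.Hom T) (k : X ⟶ W) :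
    f.iso.hom ≫ T.l ≫ k = S.l ≫ k := by
  rw [← Category.assoc, f.hom_l]

@[simp]
lemma Hom.hom_r_assoc {X Y W : C} {S T : SpanDiagram X Y} (f : S.Hom T) (k : Y ⟶ W) :
    f.iso.hom ≫ T.r ≫ k = S.r ≫ k := by
  rw [← Category.assoc, f.hom_r]

lemma Hom.ext' {X Y : C} {S T : SpanDiagram X Y} {f g : S.Hom T}
    (h : f.iso.hom = g.iso.hom) : f = g := by
  obtain ⟨f, _, _⟩ := f
  obtain ⟨g, _, _⟩ := g
  obtain rfl : f = g := Iso.ext h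
  rfl

/-- Span diagrams from `X` to `Y` and their isomorphisms. -/
instance groupoid (X Y : C) : Groupoid (SpanDiagram X Y) where
  Hom S T := Hom S T
  id S := ⟨Iso.refl _, by simp, by simp⟩
  comp f g := ⟨f.iso ≪≫ g.iso, by simp, by simp⟩
  inv f := ⟨f.iso.symm, f.iso.inv_comp_eq.2 f.hom_l.symm, f.iso.inv_comp_eq.2 f.hom_r.symm⟩
  id_comp _ := Hom.ext' (by simp)
  comp_id _ := Hom.ext' (by simp)
  assoc _ _ _ := Hom.ext' (by simp)
  inv_comp _ := Hom.ext' (by simp)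
  comp_inv _ := Hom.ext' (by simp)

@[ext]
lemma hom_ext {X Y : C} {S T : SpanDiagram X Y} {f g : S ⟶ T}
    (h : f.iso.hom = g.iso.hom) : f = g := Hom.ext' h

@[simp]
lemma id_iso {X Y : C} (S : SpanDiagram X Y) : Hom.iso (𝟙 S) = Iso.refl _ := rfl

@[simp]
lemma comp_iso {X Y : C} {S T U : SpanDiagram X Y} (f : S ⟶ T) (g : T ⟶ U) :
    Hom.iso (f ≫ g) = f.iso ≪≫ g.iso := rfl

/-- An isomorphism of span diagrams, as an isomorphism in the groupoid of span diagrams. -/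
def isoMk {X Y : C} {S T : SpanDiagram X Y} (f : S ⟶ T) : S ≅ T where
  hom := f
  inv := Groupoid.inv f

@[simp]
lemma isoMk_hom {X Y : C} {S T : SpanDiagram X Y} (f : S ⟶ T) : (isoMk f).hom = f := rfl

@[simp]
lemma isoMk_inv_iso {X Y : C} {S T : SpanDiagram X Y} (f : S ⟶ T) :
    (isoMk f).inv.iso = f.iso.symm := rfl

/-- The identity span. -/
abbrev id (X : C) : SpanDiagram X X where
  apex := X
  l := 𝟙 X
  r := 𝟙 X

/-- The composite of two spans, formed with the chosen pullback. -/
abbrev comp (P : PullbackChoice C) {X Y Z : C} (S : SpanDiagram X Y) (T : SpanDiagram Y Z) :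
    SpanDiagram X Z where
  apex := P.obj S.r T.l
  l := P.fst S.r T.l ≫ S.l
  r := P.snd S.r T.l ≫ T.r

variable (P : PullbackChoice C)

/-- The horizontal composite of two isomorphisms of spans. -/
@[simps]
noncomputable def compMap {X Y Z : C} {S S' : SpanDiagram X Y} {T T' : SpanDiagram Y Z}
    (f : S ⟶ S') (g : T ⟶ T') : comp P S T ⟶ comp P S' T' where
  iso := P.mapIso f.iso g.iso f.hom_r g.hom_l
  hom_l := by simp
  hom_r := by simp

/-- Associativity of the composition of spans. -/
@[simps]
noncomputable def assocHom {W X Y Z : C} (S : SpanDiagram W X) (T : SpanDiagram X Y)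
    (U : SpanDiagram Y Z) : comp P (comp P S T) U ⟶ comp P S (comp P T U) where
  iso := P.assocIso S.r T.l T.r U.l
  hom_l := by simp
  hom_r := by simp

/-- Left unitality of the composition of spans. -/
@[simps]
noncomputable def leftUnitHom {X Y : C} (S : SpanDiagram X Y) : comp P (id X) S ⟶ S where
  iso := P.leftUnitIso S.l
  hom_l := (P.condition (𝟙 X) S.l).symm
  hom_r := rfl

/-- Right unitality of the composition of spans. -/
@[simps]
noncomputable def rightUnitHom {X Y : C} (S : SpanDiagram X Y) : comp P S (id Y) ⟶ S where
  iso := P.rightUnitIso S.r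
  hom_l := rfl
  hom_r := P.condition S.r (𝟙 Y)

lemma compMap_id_id {X Y Z : C} (S : SpanDiagram X Y) (T : SpanDiagram Y Z) :
    compMap P (𝟙 S) (𝟙 T) = 𝟙 (comp P S T) :=
  hom_ext (P.hom_ext (by simp) (by simp))

lemma comp_compMap {X Y Z : C} {S S' S'' : SpanDiagram X Y} {T T' T'' : SpanDiagram Y Z} (f : S ⟶ S') (f' : S' ⟶ S'')
    (g : T ⟶ T') (g' : T' ⟶ T'') :
    compMap P (f ≫ f') (g ≫ g') = compMap P f g ≫ compMap P f' g' :=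
  hom_ext (P.hom_ext (by simp) (by simp))

lemma id_compMap {X Y : C} {S S' : SpanDiagram X Y} (f : S ⟶ S') :
    compMap P (𝟙 (id X)) f =
      leftUnitHom P S ≫ f ≫ (isoMk (leftUnitHom P S')).inv :=
  hom_ext (P.hom_ext (by simpa using P.condition (𝟙 X) S.l) (by simp))

lemma compMap_id {X Y : C} {S S' : SpanDiagram X Y} (f : S ⟶ S') :
    compMap P f (𝟙 (id Y)) =
      rightUnitHom P S ≫ f ≫ (isoMk (rightUnitHom P S')).inv :=
  hom_ext (P.hom_ext (by simp) (by simpa using (P.condition S.r (𝟙 Y)).symm))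

lemma assocHom_naturality {W X Y Z : C} {S S' : SpanDiagram W X} {T T' : SpanDiagram X Y} {U U' : SpanDiagram Y Z} (f : S ⟶ S')
    (g : T ⟶ T') (h : U ⟶ U') :
    compMap P (compMap P f g) h ≫ assocHom P S' T' U' =
      assocHom P S T U ≫ compMap P f (compMap P g h) :=
  hom_ext (P.hom_ext (by simp) (P.hom_ext (by simp) (by simp)))

lemma assocHom_pentagon {V W X Y Z : C} (S : SpanDiagram V W) (T : SpanDiagram W X) (U : SpanDiagram X Y) (R : SpanDiagram Y Z) :
    compMap P (assocHom P S T U) (𝟙 R) ≫ assocHom P S (comp P T U) R ≫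
        compMap P (𝟙 S) (assocHom P T U R) =
      assocHom P (comp P S T) U R ≫ assocHom P S T (comp P U R) :=
  hom_ext (P.hom_ext (by simp) (P.hom_ext (by simp) (P.hom_ext (by simp) (by simp))))

lemma assocHom_triangle {X Y Z : C} (S : SpanDiagram X Y) (T : SpanDiagram Y Z) :
    assocHom P S (id Y) T ≫ compMap P (𝟙 S) (leftUnitHom P T) =
      compMap P (rightUnitHom P S) (𝟙 T) :=
  hom_ext (P.hom_ext (by simp) (by simp))

lemma whiskerLeft_compMap {X Y Z : C} (S : SpanDiagram X Y) {T T' T'' : SpanDiagram Y Z}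
    (g : T ⟶ T') (g' : T' ⟶ T'') :
    compMap P (𝟙 S) (g ≫ g') = compMap P (𝟙 S) g ≫ compMap P (𝟙 S) g' := by
  rw [← comp_compMap, Category.id_comp]

lemma whiskerRight_compMap {X Y Z : C} {S S' S'' : SpanDiagram X Y} (f : S ⟶ S')
    (f' : S' ⟶ S'') (T : SpanDiagram Y Z) :
    compMap P (f ≫ f') (𝟙 T) = compMap P f (𝟙 T) ≫ compMap P f' (𝟙 T) := by
  rw [← comp_compMap, Category.id_comp]

lemma compMap_exchange {X Y Z : C} {S S' : SpanDiagram X Y} {T T' : SpanDiagram Y Z}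
    (f : S ⟶ S') (g : T ⟶ T') :
    compMap P (𝟙 S) g ≫ compMap P f (𝟙 T') = compMap P f (𝟙 T) ≫ compMap P (𝟙 S') g := by
  simp only [← comp_compMap, Category.id_comp, Category.comp_id]

lemma comp_whisker {W X Y Z : C} (S : SpanDiagram W X) (T : SpanDiagram X Y)
    {U U' : SpanDiagram Y Z} (h : U ⟶ U') :
    compMap P (𝟙 (comp P S T)) h = assocHom P S T U ≫ compMap P (𝟙 S) (compMap P (𝟙 T) h) ≫
      (isoMk (assocHom P S T U')).inv := by
  rw [← Category.assoc, Iso.eq_comp_inv, isoMk_hom, ← assocHom_naturality, compMap_id_id]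

lemma whisker_comp {W X Y Z : C} {S S' : SpanDiagram W X} (f : S ⟶ S') (T : SpanDiagram X Y)
    (U : SpanDiagram Y Z) :
    compMap P f (𝟙 (comp P T U)) = (isoMk (assocHom P S T U)).inv ≫
      compMap P (compMap P f (𝟙 T)) (𝟙 U) ≫ assocHom P S' T U := by
  rw [Iso.eq_inv_comp, isoMk_hom, assocHom_naturality, compMap_id_id]

lemma whisker_whisker {W X Y Z : C} (S : SpanDiagram W X) {T T' : SpanDiagram X Y} (g : T ⟶ T')
    (U : SpanDiagram Y Z) :
    compMap P (compMap P (𝟙 S) g) (𝟙 U) = assocHom P S T U ≫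
      compMap P (𝟙 S) (compMap P g (𝟙 U)) ≫ (isoMk (assocHom P S T' U)).inv := by
  rw [← Category.assoc, Iso.eq_comp_inv, isoMk_hom, assocHom_naturality]

end SpanDiagram

/-- The bicategory `2Span(C)` of spans in `C`, for a choice `P` of pullbacks: its objects are the
objects of `C`, its 1-cells are span diagrams, composed by taking chosen pullbacks, and its 2-cells
are isomorphisms of span diagrams. -/
structure TwoSpan (P : PullbackChoice C) where
  /-- the underlying object of `C` -/
  as : C

namespace TwoSpan

variable {P : PullbackChoice C}

instance : CategoryStruct (TwoSpan P) where
  Hom X Y := SpanDiagram X.as Y.as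
  id X := SpanDiagram.id X.as
  comp S T := SpanDiagram.comp P S T

instance homGroupoid (X Y : TwoSpan P) : Groupoid (X ⟶ Y) :=
  SpanDiagram.groupoid X.as Y.as

@[ext]
lemma hom₂_ext {X Y : TwoSpan P} {S T : X ⟶ Y} {f g : S ⟶ T}
    (h : f.iso.hom = g.iso.hom) : f = g := SpanDiagram.Hom.ext' h

open SpanDiagram in
noncomputable instance : Bicategory (TwoSpan P) where
  homCategory X Y := (homGroupoid X Y).toCategory
  whiskerLeft S _ _ η := compMap P ((SpanDiagram.groupoid _ _).id S) η
  whiskerRight η T := compMap P η ((SpanDiagram.groupoid _ _).id T)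
  associator S T U := isoMk (assocHom P S T U)
  leftUnitor S := isoMk (leftUnitHom P S)
  rightUnitor S := isoMk (rightUnitHom P S)
  whiskerLeft_id S T := compMap_id_id P S T
  whiskerLeft_comp S _ _ _ η θ := whiskerLeft_compMap P S η θ
  id_whiskerLeft η := id_compMap P η
  comp_whiskerLeft S T _ _ η := comp_whisker P S T η
  id_whiskerRight S T := compMap_id_id P S T
  comp_whiskerRight η θ T := whiskerRight_compMap P η θ T
  whiskerRight_id η := compMap_id P η
  whiskerRight_comp η T U := whisker_comp P η T U
  whisker_assoc S _ _ η U := whisker_whisker P S η U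
  whisker_exchange η θ := compMap_exchange P η θ
  pentagon S T U V := assocHom_pentagon P S T U V
  triangle S T := assocHom_triangle P S T

end TwoSpan

end TwoSpan

/-! ## The nerve of a bicategory -/

section BicategoryNerve

variable (B : Type u) [Bicategory.{w, v} B]

/-- An `n`-cell of the nerve of a bicategory `B` whose 2-cells are invertible: objects
`X 0, …, X n`, 1-cells `f i j : X i ⟶ X j`, and 2-cells `θ i j k : f i j ≫ f j k ⟶ f i k`
(where `≫` is in diagrammatic order), such that for all `i, j, k, l` the two 2-cells from
`(f i j ≫ f j k) ≫ f k l` to `f i l` built from the `θ`'s agree, up to the associator.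

The data are recorded for all weakly increasing indices and are normalised: `f i i` is the
identity, and `θ i i j` and `θ i j j` are the unitors. So the free data are the `f i j` for `i < j`
and the `θ i j k` for `i < j < k`, and the compatibility condition has content for `i < j < k < l`
only; recording the degenerate values makes the action of degeneracies evident. -/
structure NerveCell (n : ℕ) where
  /-- the objects -/
  X : Fin (n + 1) → B
  /-- the 1-cells -/
  f {i j : Fin (n + 1)} (hij : i ≤ j) : X i ⟶ X j
  /-- the 2-cells -/
  θ {i j k : Fin (n + 1)} (hij : i ≤ j) (hjk : j ≤ k) : f hij ≫ f hjk ⟶ f (hij.trans hjk)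
  f_self (i : Fin (n + 1)) : f (le_refl i) = 𝟙 (X i)
  θ_self_left {i j : Fin (n + 1)} (hij : i ≤ j) :
    θ (le_refl i) hij = eqToHom (f_self i) ▷ f hij ≫ (λ_ (f hij)).hom
  θ_self_right {i j : Fin (n + 1)} (hij : i ≤ j) :
    θ hij (le_refl j) = f hij ◁ eqToHom (f_self j) ≫ (ρ_ (f hij)).hom
  compatibility {i j k l : Fin (n + 1)} (hij : i ≤ j) (hjk : j ≤ k) (hkl : k ≤ l) :
    θ hij hjk ▷ f hkl ≫ θ (hij.trans hjk) hkl =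
      (α_ (f hij) (f hjk) (f hkl)).hom ≫ f hij ◁ θ hjk hkl ≫ θ hij (hjk.trans hkl)

variable {B}

/-- The restriction of a cell of the nerve along a monotone map of indices. -/
@[simps]
def NerveCell.pullback {m n : ℕ} (x : NerveCell B n) (α : Fin (m + 1) →o Fin (n + 1)) :
    NerveCell B m where
  X i := x.X (α i)
  f hij := x.f (α.monotone hij)
  θ hij hjk := x.θ (α.monotone hij) (α.monotone hjk)
  f_self i := x.f_self (α i)
  θ_self_left hij := x.θ_self_left (α.monotone hij)
  θ_self_right hij := x.θ_self_right (α.monotone hij)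
  compatibility hij hjk hkl :=
    x.compatibility (α.monotone hij) (α.monotone hjk) (α.monotone hkl)

variable (B)

/-- The nerve of a bicategory whose 2-cells are invertible. -/
def bicategoryNerve : SSet.{max u v w} where
  obj n := NerveCell B n.unop.len
  map α := TypeCat.ofHom fun x => x.pullback α.unop.toOrderHom
  map_id _ := rfl
  map_comp _ _ := rfl

end BicategoryNerve

/-! ## The simplicial set of spans -/

section Span

/-- The poset of nonempty subintervals of `{0, …, n}`, ordered by reverse inclusion. -/
abbrev IntervalPoset (n : ℕ) : Type := (NonemptyInterval (Fin (n + 1)))ᵒᵈ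

/-- Functoriality of the poset of nonempty subintervals: a monotone map `α` sends the interval
from `i` to `j` to the interval from `α i` to `α j`. -/
def IntervalPoset.map {m n : ℕ} (α : Fin (m + 1) →o Fin (n + 1)) :
    IntervalPoset m ⥤ IntervalPoset n :=
  Monotone.functor (f := fun I => OrderDual.toDual ((OrderDual.ofDual I).map α))
    fun _ _ h => ⟨α.monotone h.1, α.monotone h.2⟩

open OrderDual in
/-- The morphism in `IntervalPoset n` from an interval `U` to a subinterval `I` of `U`. -/
def IntervalPoset.incl {n : ℕ} {I U : NonemptyInterval (Fin (n + 1))} (h : I ≤ U) :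
    (toDual U : IntervalPoset n) ⟶ toDual I :=
  homOfLE h

variable {C : Type u} [Category.{v} C]

/-- The pullback property: whenever `I` and `J` are nonempty intervals with nonempty
intersection `K`, and with union `U`, the square with corners `F U`, `F I`, `F J` and `F K`
is a pullback. -/
def PullbackProperty {n : ℕ} (F : IntervalPoset n ⥤ C) : Prop :=
  ∀ (I J U K : NonemptyInterval (Fin (n + 1)))
    (hI : I ≤ U) (hJ : J ≤ U) (hI' : K ≤ I) (hJ' : K ≤ J),
    (U : Set (Fin (n + 1))) = (I : Set (Fin (n + 1))) ∪ J →
    (K : Set (Fin (n + 1))) = (I : Set (Fin (n + 1))) ∩ J →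
    IsPullback (F.map (IntervalPoset.incl hI)) (F.map (IntervalPoset.incl hJ))
      (F.map (IntervalPoset.incl hI')) (F.map (IntervalPoset.incl hJ'))

lemma coe_eq_inter_iff {n : ℕ} {I J K : NonemptyInterval (Fin (n + 1))} :
    (K : Set (Fin (n + 1))) = (I : Set (Fin (n + 1))) ∩ J ↔
      K.fst = max I.fst J.fst ∧ K.snd = min I.snd J.snd := by
  rw [NonemptyInterval.coe_def, NonemptyInterval.coe_def, NonemptyInterval.coe_def,
    Set.Icc_inter_Icc, Set.Icc_eq_Icc_iff K.fst_le_snd]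

lemma coe_eq_union_iff {n : ℕ} {I J U K : NonemptyInterval (Fin (n + 1))}
    (hK : (K : Set (Fin (n + 1))) = (I : Set (Fin (n + 1))) ∩ J) :
    (U : Set (Fin (n + 1))) = (I : Set (Fin (n + 1))) ∪ J ↔
      U.fst = min I.fst J.fst ∧ U.snd = max I.snd J.snd := by
  obtain ⟨h₁, h₂⟩ := coe_eq_inter_iff.1 hK
  have h := K.fst_le_snd
  have hI := I.fst_le_snd
  have hJ := J.fst_le_snd
  rw [h₁, h₂, max_le_iff, le_min_iff, le_min_iff] at h
  rw [NonemptyInterval.coe_def, NonemptyInterval.coe_def, NonemptyInterval.coe_def,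
    Set.Icc_union_Icc' h.2.1 h.1.2, Set.Icc_eq_Icc_iff U.fst_le_snd]

lemma PullbackProperty.comp {m n : ℕ} {F : IntervalPoset n ⥤ C} (hF : PullbackProperty F)
    (α : Fin (m + 1) →o Fin (n + 1)) : PullbackProperty (IntervalPoset.map α ⋙ F) := by
  intro I J U K hI hJ hI' hJ' hU hK
  have hKα : ((K.map α : NonemptyInterval (Fin (n + 1))) : Set (Fin (n + 1))) =
      (I.map α : Set (Fin (n + 1))) ∩ J.map α :=
    coe_eq_inter_iff.2
      ⟨(congrArg α (coe_eq_inter_iff.1 hK).1).trans (α.monotone.map_max ..),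
        (congrArg α (coe_eq_inter_iff.1 hK).2).trans (α.monotone.map_min ..)⟩
  have hUα : ((U.map α : NonemptyInterval (Fin (n + 1))) : Set (Fin (n + 1))) =
      (I.map α : Set (Fin (n + 1))) ∪ J.map α :=
    (coe_eq_union_iff hKα).2
      ⟨(congrArg α ((coe_eq_union_iff hK).1 hU).1).trans (α.monotone.map_min ..),
        (congrArg α ((coe_eq_union_iff hK).1 hU).2).trans (α.monotone.map_max ..)⟩
  exact hF (I.map α) (J.map α) (U.map α) (K.map α)
    ⟨α.monotone hI.1, α.monotone hI.2⟩ ⟨α.monotone hJ.1, α.monotone hJ.2⟩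
    ⟨α.monotone hI'.1, α.monotone hI'.2⟩ ⟨α.monotone hJ'.1, α.monotone hJ'.2⟩ hUα hKα

variable (C)

/-- The simplicial set `Span(C)`: its `n`-cells are the functors from the poset of nonempty
subintervals of `{0, …, n}` to `C` which have the pullback property. -/
def SpanSSet : SSet.{max u v} where
  obj n := { F : IntervalPoset n.unop.len ⥤ C // PullbackProperty F }
  map α := TypeCat.ofHom fun F => ⟨IntervalPoset.map α.unop.toOrderHom ⋙ F.1, F.2.comp _⟩
  map_id _ := rfl
  map_comp _ _ := rfl

end Span

/-! ## Higher categories with invertible higher cells -/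

/-- An `(n, 1)`-category: a quasicategory in which every inner horn of dimension greater than `n`
has a unique filler. -/
structure IsNOneCategory (n : ℕ) (S : SSet.{u}) : Prop where
  quasicategory : SSet.Quasicategory S
  existsUnique_filler {m : ℕ} (hm : n < m) {k : Fin (m + 1)} (h₀ : 0 < k) (h₁ : k < Fin.last m)
    (σ₀ : (Λ[m, k] : SSet.{u}) ⟶ S) : ∃! σ : Δ[m] ⟶ S, Λ[m, k].ι ≫ σ = σ₀

end SpanNerve

/-! A functor `F` on intervals has the pullback property as soon as `F[i,k]` is the pullback of
`F[i,j]` and `F[j,k]` over `F[j,j]` for all `i ≤ j ≤ k`; the other squares follow by pasting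
(`pullbackProperty_of_split`).

For the nerve, a 2-cell `θ i j k` exhibits the apex of `f i k` as the pullback of the apexes of `f i
j` and `f j k`, and so amounts to a pair of projections out of it. Tested against the projections of
an iterated pullback, the compatibility condition becomes three identities (`proj₁_proj₁`,
`proj₁_proj₂`, `proj₂_proj₂`), which say precisely that restriction to subintervals is functorial.
Conversely, a functor with the pullback property yields each `θ` as the comparison with the chosen
pullback. Both constructions commute with reindexing.

For an inner horn at `k`, an interval with `k` in its interior must be sent to the pullback, over
the value at `k`, of its part up to `k` and its part from `k` on. Intervals on one side of `k` miss
the vertex `0` or the last vertex, so the horn prescribes them and their inclusions. Hence a filler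
is obtained by gluing along these pullbacks (`GlueData.functor`), and it restricts to the given horn
because maps into a glued value are determined by their two projections. If `m > 2`, an interval and
`k` involve at most three of the at least four vertices, so the horn prescribes every object; the
maps are then forced by the pullback property (`functor_eq_of_restriction_eq`). -/

namespace SpanNerve

/-! ### Pasting of interval squares, and gluing of functors at a vertex. -/

section Gluing

variable {C : Type u} [Category.{v} C]

open IntervalPoset

/-- The interval from `i` to `j`. -/
abbrev interval {n : ℕ} {i j : Fin (n + 1)} (h : i ≤ j) : NonemptyInterval (Fin (n + 1)) :=
  ⟨(i, j), h⟩

lemma map_incl_comp {n : ℕ} (F : IntervalPoset n ⥤ C) {I J K : NonemptyInterval (Fin (n + 1))}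
    (h : J ≤ I) (h' : K ≤ J) :
    F.map (incl h) ≫ F.map (incl h') = F.map (incl (h'.trans h)) :=
  (F.map_comp _ _).symm

lemma map_incl_comp_assoc {n : ℕ} (F : IntervalPoset n ⥤ C)
    {I J K : NonemptyInterval (Fin (n + 1))} (h : J ≤ I) (h' : K ≤ J) {Z : C}
    (f : F.obj (OrderDual.toDual K) ⟶ Z) :
    F.map (incl h) ≫ F.map (incl h') ≫ f = F.map (incl (h'.trans h)) ≫ f := by
  rw [← Category.assoc, map_incl_comp]

lemma map_incl_self {n : ℕ} (F : IntervalPoset n ⥤ C) (I : NonemptyInterval (Fin (n + 1)))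
    (h : I ≤ I) : F.map (incl h) = 𝟙 _ :=
  F.map_id _

lemma isPullback_incl_of_right {n : ℕ} (F : IntervalPoset n ⥤ C)
    {A B D A' B' D' : NonemptyInterval (Fin (n + 1))} (hB : B ≤ A) (hD : D ≤ B) (hA' : A' ≤ A)
    (hBB' : B' ≤ B) (hDD' : D' ≤ D) (hB' : B' ≤ A') (hD' : D' ≤ B')
    (s : IsPullback (F.map (incl (hD.trans hB))) (F.map (incl hA')) (F.map (incl hDD'))
      (F.map (incl (hD'.trans hB'))))
    (t : IsPullback (F.map (incl hD)) (F.map (incl hBB')) (F.map (incl hDD'))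
      (F.map (incl hD'))) :
    IsPullback (F.map (incl hB)) (F.map (incl hA')) (F.map (incl hBB')) (F.map (incl hB')) := by
  rw [← map_incl_comp F hB hD, ← map_incl_comp F hB' hD'] at s
  exact IsPullback.of_right s (by simp only [map_incl_comp]) t

lemma isPullback_incl_paste {n : ℕ} (F : IntervalPoset n ⥤ C)
    {A B D A' B' D' : NonemptyInterval (Fin (n + 1))} (hB : B ≤ A) (hD : D ≤ B) (hA' : A' ≤ A)
    (hBB' : B' ≤ B) (hDD' : D' ≤ D) (hB' : B' ≤ A') (hD' : D' ≤ B')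
    (s : IsPullback (F.map (incl hB)) (F.map (incl hA')) (F.map (incl hBB')) (F.map (incl hB')))
    (t : IsPullback (F.map (incl hD)) (F.map (incl hBB')) (F.map (incl hDD'))
      (F.map (incl hD'))) :
    IsPullback (F.map (incl (hD.trans hB))) (F.map (incl hA')) (F.map (incl hDD'))
      (F.map (incl (hD'.trans hB'))) := by
  simpa only [map_incl_comp] using s.paste_horiz t

/-- The pullback property holds as soon as it holds for intervals meeting in one point. -/
lemma pullbackProperty_of_split {n : ℕ} {F : IntervalPoset n ⥤ C}
    (h : ∀ {i j k : Fin (n + 1)} (hij : i ≤ j) (hjk : j ≤ k),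
      IsPullback (F.map (incl (I := interval hij) (U := interval (hij.trans hjk)) ⟨le_rfl, hjk⟩))
        (F.map (incl (I := interval hjk) ⟨hij, le_rfl⟩))
        (F.map (incl (I := interval le_rfl) ⟨hij, le_rfl⟩))
        (F.map (incl (I := interval le_rfl) ⟨le_rfl, hjk⟩))) :
    PullbackProperty F := by
  have key : ∀ (I J U K : NonemptyInterval (Fin (n + 1)))
      (hI : I ≤ U) (hJ : J ≤ U) (hI' : K ≤ I) (hJ' : K ≤ J), I.fst ≤ J.fst →
      U.fst = min I.fst J.fst → U.snd = max I.snd J.snd →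
      K.fst = max I.fst J.fst → K.snd = min I.snd J.snd →
      IsPullback (F.map (incl hI)) (F.map (incl hJ)) (F.map (incl hI')) (F.map (incl hJ')) := by
    intro I J U K hI hJ hI' hJ' h₁ hU hU' hK hK'
    rw [min_eq_left h₁] at hU
    rw [max_eq_right h₁] at hK
    rcases le_total J.snd I.snd with h₂ | h₂
    · rw [max_eq_left h₂] at hU'
      rw [min_eq_right h₂] at hK'
      obtain rfl : U = I := NonemptyInterval.ext (Prod.ext hU hU')
      obtain rfl : K = J := NonemptyInterval.ext (Prod.ext hK hK')
      have := IsPullback.id_horiz (F.map (incl hJ))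
      rwa [← map_incl_self F U hI, ← map_incl_self F K hJ'] at this
    · rw [max_eq_right h₂] at hU'
      rw [min_eq_left h₂] at hK'
      obtain ⟨⟨i, k⟩, hik⟩ := I
      obtain ⟨⟨j, l⟩, hjl⟩ := J
      obtain ⟨⟨i', l'⟩, hil⟩ := U
      obtain ⟨⟨j', k'⟩, hjk⟩ := K
      dsimp at *
      subst hU hU' hK hK'
      -- `U` and `J` are both cut at the right end of `I`. The square for `U` is the pasting of the
      -- wanted square with the one for `J`, which can be cancelled.
      have a := h (h₁.trans hjk) h₂
      have b := h hjk h₂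
      exact (isPullback_incl_of_right F (D := interval h₂) (D' := interval (le_refl k'))
        hJ ⟨hjk, le_rfl⟩ hI hJ' ⟨le_rfl, h₂⟩ hI' ⟨hjk, le_rfl⟩ a.flip b.flip).flip
  intro I J U K hI hJ hI' hJ' hU hK
  obtain ⟨hU₁, hU₂⟩ := (coe_eq_union_iff hK).1 hU
  obtain ⟨hK₁, hK₂⟩ := coe_eq_inter_iff.1 hK
  rcases le_total I.fst J.fst with h₁ | h₁
  · exact key I J U K hI hJ hI' hJ' h₁ hU₁ hU₂ hK₁ hK₂
  · exact (key J I U K hJ hI hJ' hI' h₁ (by rw [hU₁, min_comm]) (by rw [hU₂, max_comm])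
      (by rw [hK₁, max_comm]) (by rw [hK₂, min_comm])).flip

lemma PullbackProperty.split {n : ℕ} {F : IntervalPoset n ⥤ C} (hF : PullbackProperty F)
    {i j k : Fin (n + 1)} (hij : i ≤ j) (hjk : j ≤ k) :
    IsPullback (F.map (incl (I := interval hij) (U := interval (hij.trans hjk)) ⟨le_rfl, hjk⟩))
        (F.map (incl (I := interval hjk) ⟨hij, le_rfl⟩))
        (F.map (incl (I := interval le_rfl) ⟨hij, le_rfl⟩))
        (F.map (incl (I := interval le_rfl) ⟨le_rfl, hjk⟩)) := by
  have hK : ((interval (le_refl j) : NonemptyInterval (Fin (n + 1))) : Set (Fin (n + 1))) =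
      (interval hij : Set (Fin (n + 1))) ∩ interval hjk :=
    coe_eq_inter_iff.2 ⟨(max_eq_right hij).symm, (min_eq_left hjk).symm⟩
  exact hF _ _ _ _ _ _ _ _
    ((coe_eq_union_iff hK).2 ⟨(min_eq_left hij).symm, (max_eq_right hjk).symm⟩) hK

section Parts

variable {m : ℕ} {k : Fin (m + 1)} {I J : NonemptyInterval (Fin (m + 1))}

/-- The part of an interval up to `k`. -/
def lowerPart (I : NonemptyInterval (Fin (m + 1))) (h : I.fst ≤ k) :
    NonemptyInterval (Fin (m + 1)) :=
  ⟨(I.fst, min I.snd k), le_min I.fst_le_snd h⟩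

/-- The part of an interval from `k` on. -/
def upperPart (I : NonemptyInterval (Fin (m + 1))) (h : k ≤ I.snd) :
    NonemptyInterval (Fin (m + 1)) :=
  ⟨(max I.fst k, I.snd), max_le I.fst_le_snd h⟩

lemma lowerPart_le (h : I.fst ≤ k) : lowerPart I h ≤ I := ⟨le_rfl, min_le_left _ _⟩

lemma upperPart_le (h : k ≤ I.snd) : upperPart I h ≤ I := ⟨le_max_left _ _, le_rfl⟩

lemma lowerPart_mono (h : J ≤ I) (hJ : J.fst ≤ k) :
    lowerPart J hJ ≤ lowerPart I (h.1.trans hJ) :=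
  ⟨h.1, min_le_min_right _ h.2⟩

lemma upperPart_mono (h : J ≤ I) (hJ : k ≤ J.snd) :
    upperPart J hJ ≤ upperPart I (hJ.trans h.2) :=
  ⟨max_le_max_right _ h.1, h.2⟩

lemma pure_le_lowerPart (h : I.fst ≤ k) (h' : k ≤ I.snd) :
    NonemptyInterval.pure k ≤ lowerPart I h :=
  ⟨h, le_min h' le_rfl⟩

lemma pure_le_upperPart (h : I.fst ≤ k) (h' : k ≤ I.snd) :
    NonemptyInterval.pure k ≤ upperPart I h' :=
  ⟨max_le h le_rfl, h'⟩

lemma le_lowerPart (h : J ≤ I) (hI : I.fst ≤ k) (hJ : J.snd ≤ k) : J ≤ lowerPart I hI :=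
  ⟨h.1, le_min h.2 hJ⟩

lemma le_upperPart (h : J ≤ I) (hI : k ≤ I.snd) (hJ : k ≤ J.fst) : J ≤ upperPart I hI :=
  ⟨max_le h.1 hJ, h.2⟩

/-- `k` is not an interior point of the interval `I`. -/
def OneSided (k : Fin (m + 1)) (I : NonemptyInterval (Fin (m + 1))) : Prop :=
  I.snd ≤ k ∨ k ≤ I.fst

lemma OneSided.mono (hI : OneSided k I) (h : J ≤ I) : OneSided k J :=
  hI.imp h.2.trans fun hI => hI.trans h.1

lemma oneSided_lowerPart (h : I.fst ≤ k) : OneSided k (lowerPart I h) := Or.inl (min_le_right _ _)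

lemma oneSided_upperPart (h : k ≤ I.snd) : OneSided k (upperPart I h) := Or.inr (le_max_right _ _)

end Parts

variable (C) in
/-- The data needed to glue functors on the intervals up to `k` and on the intervals from `k` on
to a functor on all intervals: in addition to the two functors, a pullback for each interval that
contains `k` in its interior. -/
structure GlueData (m : ℕ) (k : Fin (m + 1)) where
  /-- the objects -/
  obj : NonemptyInterval (Fin (m + 1)) → C
  /-- the maps between intervals on one side of `k` -/
  side {I J : NonemptyInterval (Fin (m + 1))} (h : J ≤ I) (hI : OneSided k I) : obj I ⟶ obj J
  /-- the projection to the part up to `k` -/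
  lower (I : NonemptyInterval (Fin (m + 1))) (h : I.fst ≤ k) : obj I ⟶ obj (lowerPart I h)
  /-- the projection to the part from `k` on -/
  upper (I : NonemptyInterval (Fin (m + 1))) (h : k ≤ I.snd) : obj I ⟶ obj (upperPart I h)
  side_self {I : NonemptyInterval (Fin (m + 1))} (hI : OneSided k I) : side le_rfl hI = 𝟙 (obj I)
  side_comp {I J K : NonemptyInterval (Fin (m + 1))} (h : J ≤ I) (h' : K ≤ J)
    (hI : OneSided k I) : side h hI ≫ side h' (hI.mono h) = side (h'.trans h) hI
  lower_eq {I : NonemptyInterval (Fin (m + 1))} (hI : OneSided k I) (h : I.fst ≤ k) :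
    lower I h = side (lowerPart_le h) hI
  upper_eq {I : NonemptyInterval (Fin (m + 1))} (hI : OneSided k I) (h : k ≤ I.snd) :
    upper I h = side (upperPart_le h) hI
  isPullback_of_lt (I : NonemptyInterval (Fin (m + 1))) (h : I.fst < k) (h' : k < I.snd) :
    IsPullback (lower I h.le) (upper I h'.le)
      (side (pure_le_lowerPart h.le h'.le) (oneSided_lowerPart h.le))
      (side (pure_le_upperPart h.le h'.le) (oneSided_upperPart h'.le))
  isPullback_side {i j l : Fin (m + 1)} (hij : i ≤ j) (hjl : j ≤ l)
    (hil : OneSided k (interval (hij.trans hjl))) :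
    IsPullback (side (I := interval (hij.trans hjl)) (J := interval hij) ⟨le_rfl, hjl⟩ hil)
      (side (I := interval (hij.trans hjl)) (J := interval hjl) ⟨hij, le_rfl⟩ hil)
      (side (I := interval hij) (J := interval le_rfl) ⟨hij, le_rfl⟩ (hil.mono ⟨le_rfl, hjl⟩))
      (side (I := interval hjl) (J := interval le_rfl) ⟨le_rfl, hjl⟩ (hil.mono ⟨hij, le_rfl⟩))

namespace GlueData

variable {m : ℕ} {k : Fin (m + 1)} (D : GlueData C m k)
  {I J K : NonemptyInterval (Fin (m + 1))}

attribute [simp] side_self side_comp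

@[simp]
lemma side_comp_assoc (h : J ≤ I) (h' : K ≤ J) (hI : OneSided k I) (hJ : OneSided k J)
    {Z : C} (f : D.obj K ⟶ Z) : D.side h hI ≫ D.side h' hJ ≫ f = D.side (h'.trans h) hI ≫ f := by
  rw [← Category.assoc, D.side_comp]

/-- Two opposite inclusions replace the equality `I = J`, so that no object is transported along it.
-/
lemma isIso_side (h : J ≤ I) (h' : I ≤ J) (hI : OneSided k I) : IsIso (D.side h hI) :=
  ⟨D.side h' (hI.mono h), by simp, by simp⟩

/-- If `k` is an endpoint of `I`, one projection and the opposite side of the square are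
isomorphisms. -/
lemma isPullback (I : NonemptyInterval (Fin (m + 1))) (h : I.fst ≤ k) (h' : k ≤ I.snd) :
    IsPullback (D.lower I h) (D.upper I h')
      (D.side (pure_le_lowerPart h h') (oneSided_lowerPart h))
      (D.side (pure_le_upperPart h h') (oneSided_upperPart h')) := by
  by_cases hI : OneSided k I
  · rw [D.lower_eq hI, D.upper_eq hI]
    rcases hI.imp h'.antisymm' h.antisymm with h₁ | h₁
    · have := D.isIso_side (lowerPart_le h) ⟨le_rfl, le_min le_rfl h₁.le⟩ hI
      have := D.isIso_side (pure_le_upperPart h h') ⟨le_max_right _ _, h₁.le⟩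
        (oneSided_upperPart h')
      exact IsPullback.of_horiz_isIso ⟨by simp⟩
    · have := D.isIso_side (upperPart_le h') ⟨max_le le_rfl h₁.ge, le_rfl⟩ hI
      have := D.isIso_side (pure_le_lowerPart h h') ⟨h₁.ge, min_le_right _ _⟩
        (oneSided_lowerPart h)
      exact IsPullback.of_vert_isIso ⟨by simp⟩
  · simp only [OneSided, not_or, not_le] at hI
    exact D.isPullback_of_lt I hI.2 hI.1

/-- Compatibility of a map with the projections to the parts on both sides of `k`. -/
structure Compatible (h : J ≤ I) (f : D.obj I ⟶ D.obj J) : Prop where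
  lower (hJ : J.fst ≤ k) : f ≫ D.lower J hJ =
    D.lower I (h.1.trans hJ) ≫ D.side (lowerPart_mono h hJ) (oneSided_lowerPart _)
  upper (hJ : k ≤ J.snd) : f ≫ D.upper J hJ =
    D.upper I (hJ.trans h.2) ≫ D.side (upperPart_mono h hJ) (oneSided_upperPart _)

variable {D}

/-- The projections out of `D.obj J` are jointly monic if `k` lies in `J`; otherwise the only one
that exists is an isomorphism. -/
lemma Compatible.eq {h : J ≤ I} {f f' : D.obj I ⟶ D.obj J} (hf : D.Compatible h f)
    (hf' : D.Compatible h f') : f = f' := by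
  by_cases h₁ : J.fst ≤ k
  · by_cases h₂ : k ≤ J.snd
    · exact (D.isPullback J h₁ h₂).hom_ext ((hf.lower h₁).trans (hf'.lower h₁).symm)
        ((hf.upper h₂).trans (hf'.upper h₂).symm)
    · have e := (hf.lower h₁).trans (hf'.lower h₁).symm
      have hJ : OneSided k J := Or.inl (not_le.1 h₂).le
      have := D.isIso_side (lowerPart_le h₁) (le_lowerPart le_rfl h₁ (not_le.1 h₂).le) hJ
      rwa [D.lower_eq hJ, cancel_mono] at e
  · have hJ' := not_le.1 h₁
    have h₂ : k ≤ J.snd := hJ'.le.trans J.fst_le_snd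
    have e := (hf.upper h₂).trans (hf'.upper h₂).symm
    have hJ : OneSided k J := Or.inr hJ'.le
    have := D.isIso_side (upperPart_le h₂) (le_upperPart le_rfl h₂ hJ'.le) hJ
    rwa [D.upper_eq hJ, cancel_mono] at e

variable (D)

/-- If `k` lies in `J`, the universal property gives the map; otherwise `J` lies in one part of `I`,
and the map is the projection to that part followed by a side map. -/
lemma exists_compatible (h : J ≤ I) : ∃ f, D.Compatible h f := by
  by_cases h₁ : J.fst ≤ k
  · by_cases h₂ : k ≤ J.snd
    · refine ⟨(D.isPullback J h₁ h₂).lift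
        (D.lower I (h.1.trans h₁) ≫ D.side (lowerPart_mono h h₁) (oneSided_lowerPart _))
        (D.upper I (h₂.trans h.2) ≫ D.side (upperPart_mono h h₂) (oneSided_upperPart _)) ?_,
        ⟨fun _ => IsPullback.lift_fst .., fun _ => IsPullback.lift_snd ..⟩⟩
      simpa using (D.isPullback I (h.1.trans h₁) (h₂.trans h.2)).w
    · have hJ : OneSided k J := Or.inl (not_le.1 h₂).le
      refine ⟨D.lower I (h.1.trans h₁) ≫ D.side (le_lowerPart h _ (not_le.1 h₂).le)
        (oneSided_lowerPart _), ⟨fun _ => ?_, fun h₃ => (h₂ h₃).elim⟩⟩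
      simp [D.lower_eq hJ]
  · have hJ' := not_le.1 h₁
    have h₂ : k ≤ J.snd := hJ'.le.trans J.fst_le_snd
    have hJ : OneSided k J := Or.inr hJ'.le
    refine ⟨D.upper I (h₂.trans h.2) ≫ D.side (le_upperPart h _ hJ'.le)
      (oneSided_upperPart _), ⟨fun h₃ => (h₁ h₃).elim, fun _ => ?_⟩⟩
    simp [D.upper_eq hJ]

lemma compatible_id (I : NonemptyInterval (Fin (m + 1))) : D.Compatible (le_refl I) (𝟙 _) :=
  ⟨fun _ => by simp, fun _ => by simp⟩

variable {D} in
lemma Compatible.comp {h : J ≤ I} {h' : K ≤ J} {f : D.obj I ⟶ D.obj J} {f' : D.obj J ⟶ D.obj K}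
    (hf : D.Compatible h f) (hf' : D.Compatible h' f') :
    D.Compatible (h'.trans h) (f ≫ f') where
  lower hK := by
    rw [Category.assoc, hf'.lower, ← Category.assoc, hf.lower, Category.assoc, D.side_comp]
  upper hK := by
    rw [Category.assoc, hf'.upper, ← Category.assoc, hf.upper, Category.assoc, D.side_comp]

/-- The functor on all intervals obtained by gluing. -/
noncomputable def functor : IntervalPoset m ⥤ C where
  obj I := D.obj (OrderDual.ofDual I)
  map f := (D.exists_compatible (leOfHom f)).choose
  map_id _ := (D.exists_compatible _).choose_spec.eq (D.compatible_id _)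
  map_comp _ _ := (D.exists_compatible _).choose_spec.eq
    ((D.exists_compatible _).choose_spec.comp (D.exists_compatible _).choose_spec)

variable {D} in
lemma Compatible.map_eq {h : J ≤ I} {f : D.obj I ⟶ D.obj J} (hf : D.Compatible h f) :
    D.functor.map (incl h) = f :=
  (D.exists_compatible _).choose_spec.eq hf

lemma functor_map_side (h : J ≤ I) (hI : OneSided k I) :
    D.functor.map (incl h) = D.side h hI := by
  apply Compatible.map_eq
  constructor
  · intro hJ
    simp [D.lower_eq hI, D.lower_eq (hI.mono h)]
  · intro hJ
    simp [D.upper_eq hI, D.upper_eq (hI.mono h)]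

lemma functor_map_lower (h : I.fst ≤ k) :
    D.functor.map (incl (lowerPart_le h)) = D.lower I h := by
  apply Compatible.map_eq
  constructor
  · intro hJ
    rw [D.lower_eq (oneSided_lowerPart h)]
  · intro hJ
    have h' : k ≤ I.snd := hJ.trans (min_le_left _ _)
    have := (D.isPullback I h h').w
    -- The upper part of the lower part is the point `k`, so the claim is the commutativity of the
    -- gluing square.
    have e : upperPart (lowerPart I h) hJ ≤ NonemptyInterval.pure k :=
      ⟨le_max_right _ _, min_le_right _ _⟩
    rw [D.upper_eq (oneSided_lowerPart h),
      ← D.side_comp (pure_le_lowerPart h h') e, ← Category.assoc, this]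
    simp

lemma functor_map_upper (h : k ≤ I.snd) :
    D.functor.map (incl (upperPart_le h)) = D.upper I h := by
  apply Compatible.map_eq
  constructor
  · intro hJ
    have h' : I.fst ≤ k := (le_max_left _ _).trans hJ
    have := (D.isPullback I h' h).w
    have e : lowerPart (upperPart I h) hJ ≤ NonemptyInterval.pure k :=
      ⟨le_max_right _ _, min_le_right _ _⟩
    rw [D.lower_eq (oneSided_upperPart h),
      ← D.side_comp (pure_le_upperPart h' h) e, ← Category.assoc, ← this]
    simp
  · intro hJ
    rw [D.upper_eq (oneSided_upperPart h)]

lemma isPullback_functor_split {i l : Fin (m + 1)} (hi : i ≤ k) (hl : k ≤ l) :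
    IsPullback
      (D.functor.map (incl (I := interval hi) (U := interval (hi.trans hl)) ⟨le_rfl, hl⟩))
      (D.functor.map (incl (I := interval hl) ⟨hi, le_rfl⟩))
      (D.functor.map (incl (I := interval le_rfl) ⟨hi, le_rfl⟩))
      (D.functor.map (incl (I := interval le_rfl) ⟨le_rfl, hl⟩)) := by
  -- The two parts equal `[i,k]` and `[k,l]` only up to simplifying `min` and `max`; generalising
  -- them allows substitution.
  have key (A B : NonemptyInterval (Fin (m + 1))) (hA : A = lowerPart (interval (hi.trans hl)) hi)
      (hB : B = upperPart (interval (hi.trans hl)) hl) :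
      IsPullback (D.functor.map (incl (hA.le.trans (lowerPart_le _))))
        (D.functor.map (incl (hB.le.trans (upperPart_le _))))
        (D.functor.map (incl ((pure_le_lowerPart hi hl).trans hA.ge)))
        (D.functor.map (incl ((pure_le_upperPart hi hl).trans hB.ge))) := by
    subst hA hB
    rw [functor_map_lower, functor_map_upper, D.functor_map_side _ (oneSided_lowerPart _),
      D.functor_map_side _ (oneSided_upperPart _)]
    exact D.isPullback _ hi hl
  exact key (interval hi) (interval hl)
    (NonemptyInterval.ext (Prod.ext rfl (min_eq_right hl).symm))
    (NonemptyInterval.ext (Prod.ext (max_eq_right hi).symm rfl))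

lemma pullbackProperty_functor : PullbackProperty D.functor := by
  have side {i j l : Fin (m + 1)} (hij : i ≤ j) (hjl : j ≤ l)
      (hil : OneSided k (interval (hij.trans hjl))) := by
    have := D.isPullback_side hij hjl hil
    rwa [← D.functor_map_side, ← D.functor_map_side, ← D.functor_map_side,
      ← D.functor_map_side] at this
  refine pullbackProperty_of_split fun {i j l} hij hjl => ?_
  by_cases hil : OneSided k (interval (hij.trans hjl))
  · exact side hij hjl hil
  · simp only [OneSided, not_or, not_le] at hil
    rcases le_total j k with hjk | hjk
    -- Cutting `[i,l]` and `[j,l]` at `k` and cancelling shows that `[i,l]` is the pullback of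
    -- `[i,k]` and `[j,l]` over `[j,k]`. Pasting with `[i,k]` cut at `j`, which lies on one side of
    -- `k`, gives the square for `j`.
    · have a := D.isPullback_functor_split hil.2.le hil.1.le
      have b := D.isPullback_functor_split hjk hil.1.le
      have c := side hij hjk (Or.inl le_rfl)
      have d := isPullback_incl_of_right D.functor (A := interval (hij.trans hjl))
        (A' := interval hil.2.le) (B := interval hjl) (B' := interval hjk)
        (D := interval hil.1.le) (D' := interval le_rfl)
        ⟨hij, le_rfl⟩ ⟨hjk, le_rfl⟩ ⟨le_rfl, hil.1.le⟩ ⟨le_rfl, hil.1.le⟩ ⟨le_rfl, hil.1.le⟩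
        ⟨hij, le_rfl⟩ ⟨hjk, le_rfl⟩ a.flip b.flip
      exact isPullback_incl_paste D.functor _ _ _ _ _ _ _ d.flip c
    · have a := D.isPullback_functor_split hil.2.le hil.1.le
      have b := D.isPullback_functor_split hil.2.le hjk
      have c := side hjk hjl (Or.inr le_rfl)
      have d := isPullback_incl_of_right D.functor (A := interval (hij.trans hjl))
        (A' := interval hil.1.le) (B := interval hij) (B' := interval hjk)
        (D := interval hil.2.le) (D' := interval le_rfl)
        ⟨le_rfl, hjl⟩ ⟨le_rfl, hjk⟩ ⟨hil.2.le, le_rfl⟩ ⟨hil.2.le, le_rfl⟩ ⟨hil.2.le, le_rfl⟩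
        ⟨le_rfl, hjl⟩ ⟨le_rfl, hjk⟩ a b
      exact (isPullback_incl_paste D.functor _ _ _ _ _ _ _ d.flip c.flip).flip

end GlueData

end Gluing

/-! ### The values of a horn on intervals and their inclusions. -/

section Horn

variable {C : Type u} [Category.{v} C]

open IntervalPoset OrderDual

/-- The simplex `τ` lies on a face of the standard simplex that contains the vertex `k`. -/
def InHorn {m n : ℕ} (k : Fin (m + 1)) (τ : Fin (n + 1) →o Fin (m + 1)) : Prop :=
  ∃ j, j ≠ k ∧ ∀ a, τ a ≠ j

lemma inHorn_iff {m n : ℕ} (k : Fin (m + 1)) (τ : Fin (n + 1) →o Fin (m + 1)) :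
    InHorn k τ ↔ (SSet.stdSimplex.objMk τ : (Δ[m] : SSet.{u}).obj (op ⦋n⦌)) ∈ Λ[m, k].obj _ := by
  rw [SSet.mem_horn_iff_notMem_range]
  simp [InHorn]

lemma InHorn.comp {m n l : ℕ} {k : Fin (m + 1)} {τ : Fin (n + 1) →o Fin (m + 1)}
    (h : InHorn k τ) (α : Fin (l + 1) →o Fin (n + 1)) : InHorn k (τ.comp α) :=
  h.imp fun _ h => ⟨h.1, fun _ => h.2 _⟩

variable {m : ℕ} {k : Fin (m + 1)} (σ : (Λ[m, k] : SSet.{max u v}) ⟶ SpanSSet C)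

/-- The functor which a map from a horn to `Span(C)` assigns to a simplex of the horn. -/
def hornFunctor {n : ℕ} (τ : Fin (n + 1) →o Fin (m + 1)) (h : InHorn k τ) :
    IntervalPoset n ⥤ C :=
  (σ.app (op ⦋n⦌) ⟨SSet.stdSimplex.objMk τ, (inHorn_iff k τ).1 h⟩).1

lemma pullbackProperty_hornFunctor {n : ℕ} (τ : Fin (n + 1) →o Fin (m + 1)) (h : InHorn k τ) :
    PullbackProperty (hornFunctor σ τ h) :=
  (σ.app (op ⦋n⦌) ⟨SSet.stdSimplex.objMk τ, (inHorn_iff k τ).1 h⟩).2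

lemma hornFunctor_comp {n l : ℕ} (τ : Fin (n + 1) →o Fin (m + 1)) (h : InHorn k τ)
    (α : Fin (l + 1) →o Fin (n + 1)) :
    hornFunctor σ (τ.comp α) (h.comp α) = IntervalPoset.map α ⋙ hornFunctor σ τ h := by
  let x : Λ[m, k].toSSet.obj (op ⦋n⦌) := ⟨SSet.stdSimplex.objMk τ, (inHorn_iff k τ).1 h⟩
  have e := NatTrans.naturality_apply σ
    (Quiver.Hom.op (SimplexCategory.Hom.mk α : ⦋l⦌ ⟶ ⦋n⦌)) x
  exact congrArg Subtype.val e

/-- The interval `I` as an edge of the standard simplex. -/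
def edgeHom (I : NonemptyInterval (Fin (m + 1))) : Fin 2 →o Fin (m + 1) where
  toFun := ![I.fst, I.snd]
  monotone' := Fin.monotone_iff_le_succ.2 fun i => by
    fin_cases i
    exact I.fst_le_snd

/-- An inclusion of intervals, as a 3-simplex of the standard simplex. -/
def quadHom {I J : NonemptyInterval (Fin (m + 1))} (h : J ≤ I) : Fin 4 →o Fin (m + 1) where
  toFun := ![I.fst, J.fst, J.snd, I.snd]
  monotone' := Fin.monotone_iff_le_succ.2 fun i => by
    fin_cases i
    exacts [h.1, J.fst_le_snd, h.2]

lemma inHorn_edgeHom {I : NonemptyInterval (Fin (m + 1))} {j : Fin (m + 1)} (hj : j ≠ k)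
    (h : I.fst ≠ j ∧ I.snd ≠ j) : InHorn k (edgeHom I) :=
  ⟨j, hj, Fin.forall_fin_two.2 h⟩

lemma inHorn_quadHom {I J : NonemptyInterval (Fin (m + 1))} (hJI : J ≤ I) {j : Fin (m + 1)}
    (hj : j ≠ k) (hI : I.fst ≠ j ∧ I.snd ≠ j) (hJ : J.fst ≠ j ∧ J.snd ≠ j) :
    InHorn k (quadHom hJI) :=
  ⟨j, hj, fun a => by fin_cases a; exacts [hI.1, hJ.1, hJ.2, hI.2]⟩

lemma comp_edgeHom {n : ℕ} (τ : Fin (n + 1) →o Fin (m + 1)) (I : NonemptyInterval (Fin (n + 1))) :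
    τ.comp (edgeHom I) = edgeHom (I.map τ) := by
  ext a : 2
  fin_cases a <;> rfl

lemma comp_quadHom {n : ℕ} (τ : Fin (n + 1) →o Fin (m + 1))
    {I J : NonemptyInterval (Fin (n + 1))} (h : J ≤ I) (h' : J.map τ ≤ I.map τ) :
    τ.comp (quadHom h) = quadHom h' := by
  ext a : 2
  fin_cases a <;> rfl

/-- The edge of the 1-simplex. -/
abbrev edgeInterval : NonemptyInterval (Fin (1 + 1)) := ⟨(0, 1), by decide⟩

/-- The longest interval in the 3-simplex. -/
abbrev outerInterval : NonemptyInterval (Fin (3 + 1)) := ⟨(0, 3), by decide⟩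

/-- The middle interval in the 3-simplex. -/
abbrev midInterval : NonemptyInterval (Fin (3 + 1)) := ⟨(1, 2), by decide⟩

lemma midInterval_le : midInterval ≤ outerInterval := by decide

/-- The object which a map from a horn to `Span(C)` assigns to an interval. -/
def hornObj (I : NonemptyInterval (Fin (m + 1))) (h : InHorn k (edgeHom I)) : C :=
  (hornFunctor σ (edgeHom I) h).obj (toDual edgeInterval)

lemma hornFunctor_obj {n : ℕ} (τ : Fin (n + 1) →o Fin (m + 1)) (h : InHorn k τ)
    (I : NonemptyInterval (Fin (n + 1))) (hI : InHorn k (edgeHom (I.map τ))) :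
    (hornFunctor σ τ h).obj (toDual I) = hornObj σ (I.map τ) hI := by
  -- The two descriptions of the edge agree only propositionally, so the edge is generalised before
  -- substituting.
  have key (τ' : Fin 2 →o Fin (m + 1)) (h' : InHorn k τ') (e : τ.comp (edgeHom I) = τ') :
      (hornFunctor σ τ h).obj (toDual I) = (hornFunctor σ τ' h').obj (toDual edgeInterval) := by
    subst e
    rw [hornFunctor_comp σ τ h]
    rfl
  exact key _ hI (comp_edgeHom τ I)

lemma hornFunctor_quadHom_top {I J : NonemptyInterval (Fin (m + 1))} (h : J ≤ I)
    (hIJ : InHorn k (quadHom h)) (hI : InHorn k (edgeHom I)) :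
    (hornFunctor σ (quadHom h) hIJ).obj (toDual outerInterval) = hornObj σ I hI :=
  hornFunctor_obj σ (quadHom h) hIJ outerInterval hI

lemma hornFunctor_quadHom_mid {I J : NonemptyInterval (Fin (m + 1))} (h : J ≤ I)
    (hIJ : InHorn k (quadHom h)) (hJ : InHorn k (edgeHom J)) :
    (hornFunctor σ (quadHom h) hIJ).obj (toDual midInterval) = hornObj σ J hJ :=
  hornFunctor_obj σ (quadHom h) hIJ midInterval hJ

/-- The morphism which a map from a horn to `Span(C)` assigns to an inclusion of intervals. -/
def hornMap {I J : NonemptyInterval (Fin (m + 1))} (h : J ≤ I) (hIJ : InHorn k (quadHom h))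
    (hI : InHorn k (edgeHom I)) (hJ : InHorn k (edgeHom J)) : hornObj σ I hI ⟶ hornObj σ J hJ :=
  eqToHom (hornFunctor_quadHom_top σ h hIJ hI).symm ≫
    (hornFunctor σ (quadHom h) hIJ).map (incl midInterval_le) ≫
      eqToHom (hornFunctor_quadHom_mid σ h hIJ hJ)

/-- By naturality of `σ`, any simplex of the horn containing the four endpoints computes the map.
Laws for `hornMap` can thus be checked inside a single face, where the horn is an actual functor. -/
lemma hornMap_map {n : ℕ} (τ : Fin (n + 1) →o Fin (m + 1)) (h : InHorn k τ)
    {I J : NonemptyInterval (Fin (n + 1))} (hJI : J ≤ I) (hJI' : J.map τ ≤ I.map τ)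
    (hIJ : InHorn k (quadHom hJI')) (hI : InHorn k (edgeHom (I.map τ)))
    (hJ : InHorn k (edgeHom (J.map τ))) :
    hornMap σ hJI' hIJ hI hJ = eqToHom (hornFunctor_obj σ τ h I hI).symm ≫
      (hornFunctor σ τ h).map (incl hJI) ≫ eqToHom (hornFunctor_obj σ τ h J hJ) := by
  have key (τ' : Fin 4 →o Fin (m + 1)) (h' : InHorn k τ') (e : τ.comp (quadHom hJI) = τ') :
      ∃ (e₁ : (hornFunctor σ τ' h').obj (toDual outerInterval) = (hornFunctor σ τ h).obj (toDual I))
        (e₂ : (hornFunctor σ τ h).obj (toDual J) =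
          (hornFunctor σ τ' h').obj (toDual midInterval)),
        (hornFunctor σ τ' h').map (incl midInterval_le) = eqToHom e₁ ≫
          (hornFunctor σ τ h).map (incl hJI) ≫ eqToHom e₂ := by
    subst e
    have e := hornFunctor_comp σ τ h (quadHom hJI)
    exact ⟨congrArg (fun F => F.obj (toDual outerInterval)) e,
      (congrArg (fun F => F.obj (toDual midInterval)) e).symm, Functor.congr_hom e _⟩
  obtain ⟨e₁, e₂, e₃⟩ := key _ hIJ (comp_quadHom τ hJI hJI')
  simp [hornMap, e₃]

end Horn

/-! ### Existence of fillers of inner horns. -/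

section HornFilling

variable {C : Type u} [Category.{v} C]

open IntervalPoset OrderDual

lemma isPullback_eqToHom {X₁ X₂ X₃ X₄ Y₁ Y₂ Y₃ Y₄ : C} {f : X₁ ⟶ X₂} {g : X₁ ⟶ X₃} {f' : X₂ ⟶ X₄}
    {g' : X₃ ⟶ X₄} (h : IsPullback f g f' g') (e₁ : X₁ = Y₁) (e₂ : X₂ = Y₂) (e₃ : X₃ = Y₃)
    (e₄ : X₄ = Y₄) :
    IsPullback (eqToHom e₁.symm ≫ f ≫ eqToHom e₂) (eqToHom e₁.symm ≫ g ≫ eqToHom e₃)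
      (eqToHom e₂.symm ≫ f' ≫ eqToHom e₄) (eqToHom e₃.symm ≫ g' ≫ eqToHom e₄) := by
  subst e₁ e₂ e₃ e₄
  simpa using h

lemma eq_of_eqToHom_conj {X X' X'' Y Y' Y'' : C} {f : X ⟶ Y} {g : X'' ⟶ Y''} {e₁ : X = X'}
    {e₂ : X' = X''} {e₃ : Y'' = Y'} {e₄ : Y' = Y}
    (h : f = eqToHom e₁ ≫ (eqToHom e₂ ≫ g ≫ eqToHom e₃) ≫ eqToHom e₄) :
    f = eqToHom (e₁.trans e₂) ≫ g ≫ eqToHom (e₃.trans e₄) := by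
  simpa using h

variable {m : ℕ} {k : Fin (m + 1)} (σ : (Λ[m, k] : SSet.{max u v}) ⟶ SpanSSet C)

/-- The vertex `j` is not an endpoint of the interval `I`. -/
def Avoids (j : Fin (m + 1)) (I : NonemptyInterval (Fin (m + 1))) : Prop :=
  I.fst ≠ j ∧ I.snd ≠ j

variable {j : Fin (m + 1)} {I J K : NonemptyInterval (Fin (m + 1))}

lemma Avoids.inHorn (h : Avoids j I) (hj : j ≠ k) : InHorn k (edgeHom I) :=
  inHorn_edgeHom hj h

lemma Avoids.inHorn_quad (hI : Avoids j I) (hJ : Avoids j J) (hj : j ≠ k) (h : J ≤ I) :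
    InHorn k (quadHom h) :=
  inHorn_quadHom h hj hI hJ

lemma avoids_pure (hj : j ≠ k) : Avoids j (NonemptyInterval.pure k) := ⟨hj.symm, hj.symm⟩

lemma Avoids.lowerPart (hI : Avoids j I) (hj : j ≠ k) (h : I.fst ≤ k) :
    Avoids j (lowerPart I h) := by
  refine ⟨hI.1, ?_⟩
  rcases min_choice I.snd k with h | h <;> simp only [SpanNerve.lowerPart, h]
  exacts [hI.2, hj.symm]

lemma Avoids.upperPart (hI : Avoids j I) (hj : j ≠ k) (h : k ≤ I.snd) :
    Avoids j (upperPart I h) := by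
  refine ⟨?_, hI.2⟩
  rcases max_choice I.fst k with h | h <;> simp only [SpanNerve.upperPart, h]
  exacts [hI.1, hj.symm]

/-- The face opposite to `j` contains all intervals that avoid `j`. -/
lemma exists_face (hj : j ≠ k) : ∃ (n : ℕ) (τ : Fin (n + 1) →o Fin (m + 1)), InHorn k τ ∧
    (∀ a b, τ a ≤ τ b → a ≤ b) ∧ ∀ i, i ≠ j → ∃ a, τ a = i := by
  cases m with
  | zero => exact (hj (Fin.ext (by omega))).elim
  | succ m =>
    exact ⟨m, (Fin.succAboveOrderEmb j).toOrderHom, ⟨j, hj, fun a => Fin.succAbove_ne j a⟩,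
      fun a b h => (Fin.succAboveOrderEmb j).le_iff_le.1 h,
      fun i hi => Fin.exists_succAbove_eq hi⟩

lemma Avoids.exists_map_eq {n : ℕ} {τ : Fin (n + 1) →o Fin (m + 1)} (hI : Avoids j I)
    (hτ : ∀ a b, τ a ≤ τ b → a ≤ b) (hτ' : ∀ i, i ≠ j → ∃ a, τ a = i) :
    ∃ A : NonemptyInterval (Fin (n + 1)), A.map τ = I := by
  obtain ⟨⟨a, b⟩, hab⟩ := I
  obtain ⟨a, rfl⟩ := hτ' a hI.1
  obtain ⟨b, rfl⟩ := hτ' b hI.2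
  exact ⟨⟨(a, b), hτ _ _ hab⟩, rfl⟩

lemma hornMap_self (hj : j ≠ k) (hI : Avoids j I) (h : I ≤ I) (h₁ : InHorn k (quadHom h))
    (h₂ h₃ : InHorn k (edgeHom I)) : hornMap σ h h₁ h₂ h₃ = 𝟙 _ := by
  obtain ⟨n, τ, hτ, hle, hsurj⟩ := exists_face hj
  obtain ⟨A, rfl⟩ := hI.exists_map_eq hle hsurj
  rw [hornMap_map σ τ hτ le_rfl, map_incl_self]
  simp

/-- A common avoided vertex `j` places all three intervals in the face opposite to `j`, where the
law is functoriality. -/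
lemma hornMap_comp (hj : j ≠ k) (hI : Avoids j I) (hJ : Avoids j J) (hK : Avoids j K)
    (h : J ≤ I) (h' : K ≤ J) (hIJ : InHorn k (quadHom h)) (hJK : InHorn k (quadHom h'))
    (hIK : InHorn k (quadHom (h'.trans h)))
    (h₁ : InHorn k (edgeHom I)) (h₂ : InHorn k (edgeHom J)) (h₃ : InHorn k (edgeHom K)) :
    hornMap σ h hIJ h₁ h₂ ≫ hornMap σ h' hJK h₂ h₃ = hornMap σ (h'.trans h) hIK h₁ h₃ := by
  obtain ⟨n, τ, hτ, hle, hsurj⟩ := exists_face hj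
  obtain ⟨A, rfl⟩ := hI.exists_map_eq hle hsurj
  obtain ⟨B, rfl⟩ := hJ.exists_map_eq hle hsurj
  obtain ⟨D, rfl⟩ := hK.exists_map_eq hle hsurj
  have hBA : B ≤ A := ⟨hle _ _ h.1, hle _ _ h.2⟩
  have hDB : D ≤ B := ⟨hle _ _ h'.1, hle _ _ h'.2⟩
  rw [hornMap_map σ τ hτ hBA, hornMap_map σ τ hτ hDB, hornMap_map σ τ hτ (hDB.trans hBA)]
  simp [map_incl_comp_assoc]

lemma isPullback_hornMap (hj : j ≠ k) {a b c : Fin (m + 1)} (hab : a ≤ b) (hbc : b ≤ c)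
    (ha : a ≠ j) (hb : b ≠ j) (hc : c ≠ j) :
    IsPullback
      (hornMap σ (I := interval (hab.trans hbc)) (J := interval hab) ⟨le_rfl, hbc⟩
        (inHorn_quadHom _ hj ⟨ha, hc⟩ ⟨ha, hb⟩) (inHorn_edgeHom hj ⟨ha, hc⟩)
        (inHorn_edgeHom hj ⟨ha, hb⟩))
      (hornMap σ (I := interval (hab.trans hbc)) (J := interval hbc) ⟨hab, le_rfl⟩
        (inHorn_quadHom _ hj ⟨ha, hc⟩ ⟨hb, hc⟩) (inHorn_edgeHom hj ⟨ha, hc⟩)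
        (inHorn_edgeHom hj ⟨hb, hc⟩))
      (hornMap σ (I := interval hab) (J := interval le_rfl) ⟨hab, le_rfl⟩
        (inHorn_quadHom _ hj ⟨ha, hb⟩ ⟨hb, hb⟩) (inHorn_edgeHom hj ⟨ha, hb⟩)
        (inHorn_edgeHom hj ⟨hb, hb⟩))
      (hornMap σ (I := interval hbc) (J := interval le_rfl) ⟨le_rfl, hbc⟩
        (inHorn_quadHom _ hj ⟨hb, hc⟩ ⟨hb, hb⟩) (inHorn_edgeHom hj ⟨hb, hc⟩)
        (inHorn_edgeHom hj ⟨hb, hb⟩)) := by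
  obtain ⟨n, τ, hτ, hle, hsurj⟩ := exists_face hj
  obtain ⟨a, rfl⟩ := hsurj _ ha
  obtain ⟨b, rfl⟩ := hsurj _ hb
  obtain ⟨c, rfl⟩ := hsurj _ hc
  have hab' := hle _ _ hab
  have hbc' := hle _ _ hbc
  have := isPullback_eqToHom
    ((pullbackProperty_hornFunctor σ τ hτ).split hab' hbc')
    (hornFunctor_obj σ τ hτ (interval (hab'.trans hbc')) (inHorn_edgeHom hj ⟨ha, hc⟩))
    (hornFunctor_obj σ τ hτ (interval hab') (inHorn_edgeHom hj ⟨ha, hb⟩))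
    (hornFunctor_obj σ τ hτ (interval hbc') (inHorn_edgeHom hj ⟨hb, hc⟩))
    (hornFunctor_obj σ τ hτ (interval le_rfl) (inHorn_edgeHom hj ⟨hb, hb⟩))
  rw [← hornMap_map σ τ hτ (I := interval (hab'.trans hbc')) (J := interval hab') _
      ⟨le_rfl, hbc⟩ (inHorn_quadHom _ hj ⟨ha, hc⟩ ⟨ha, hb⟩),
    ← hornMap_map σ τ hτ (I := interval (hab'.trans hbc')) (J := interval hbc') _
      ⟨hab, le_rfl⟩ (inHorn_quadHom _ hj ⟨ha, hc⟩ ⟨hb, hc⟩),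
    ← hornMap_map σ τ hτ (I := interval hab') (J := interval le_rfl) _
      ⟨hab, le_rfl⟩ (inHorn_quadHom _ hj ⟨ha, hb⟩ ⟨hb, hb⟩),
    ← hornMap_map σ τ hτ (I := interval hbc') (J := interval le_rfl) _
      ⟨le_rfl, hbc⟩ (inHorn_quadHom _ hj ⟨hb, hc⟩ ⟨hb, hb⟩)] at this
  exact this

lemma isPullback_hornMap_parts (hj : j ≠ k) (hI : Avoids j I) (h : I.fst ≤ k) (h' : k ≤ I.snd) :
    IsPullback
      (hornMap σ (lowerPart_le h) (hI.inHorn_quad (hI.lowerPart hj h) hj _) (hI.inHorn hj)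
        ((hI.lowerPart hj h).inHorn hj))
      (hornMap σ (upperPart_le h') (hI.inHorn_quad (hI.upperPart hj h') hj _) (hI.inHorn hj)
        ((hI.upperPart hj h').inHorn hj))
      (hornMap σ (pure_le_lowerPart h h') ((hI.lowerPart hj h).inHorn_quad (avoids_pure hj) hj _)
        ((hI.lowerPart hj h).inHorn hj) ((avoids_pure hj).inHorn hj))
      (hornMap σ (pure_le_upperPart h h') ((hI.upperPart hj h').inHorn_quad (avoids_pure hj) hj _)
        ((hI.upperPart hj h').inHorn hj) ((avoids_pure hj).inHorn hj)) := by
  have key (A B : NonemptyInterval (Fin (m + 1))) (hA : interval h = A) (hB : interval h' = B)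
      (h₁ : A ≤ I) (h₂ : B ≤ I) (h₃ : NonemptyInterval.pure k ≤ A)
      (h₄ : NonemptyInterval.pure k ≤ B) (hjA : Avoids j A) (hjB : Avoids j B) :
      IsPullback
        (hornMap σ h₁ (hI.inHorn_quad hjA hj _) (hI.inHorn hj) (hjA.inHorn hj))
        (hornMap σ h₂ (hI.inHorn_quad hjB hj _) (hI.inHorn hj) (hjB.inHorn hj))
        (hornMap σ h₃ (hjA.inHorn_quad (avoids_pure hj) hj _) (hjA.inHorn hj)
          ((avoids_pure hj).inHorn hj))
        (hornMap σ h₄ (hjB.inHorn_quad (avoids_pure hj) hj _) (hjB.inHorn hj)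
          ((avoids_pure hj).inHorn hj)) := by
    subst hA hB
    exact isPullback_hornMap σ hj h h' hI.1 hj.symm hI.2
  exact key (lowerPart I h) (upperPart I h') (NonemptyInterval.ext (Prod.ext rfl (min_eq_right h').symm))
    (NonemptyInterval.ext (Prod.ext (max_eq_right h).symm rfl)) _ _ _ _
    (hI.lowerPart hj h) (hI.upperPart hj h')

/-- This is where the horn being inner matters: the vertex `0` or the last vertex is avoided, and
neither is `k`. -/
lemma OneSided.exists_avoids (h₀ : 0 < k) (h₁ : k < Fin.last m) (hI : OneSided k I) :
    ∃ j, j ≠ k ∧ ∀ J ≤ I, Avoids j J := by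
  rcases hI with hI | hI
  · refine ⟨Fin.last m, h₁.ne', fun J hJ => ?_⟩
    have h := (hJ.2.trans hI).trans_lt h₁
    exact ⟨(J.fst_le_snd.trans_lt h).ne, h.ne⟩
  · refine ⟨0, h₀.ne, fun J hJ => ?_⟩
    have h := h₀.trans_le (hI.trans hJ.1)
    exact ⟨h.ne', (h.trans_le J.fst_le_snd).ne'⟩

lemma OneSided.inHorn (h₀ : 0 < k) (h₁ : k < Fin.last m) (hI : OneSided k I) :
    InHorn k (edgeHom I) :=
  let ⟨_, hj, h⟩ := hI.exists_avoids h₀ h₁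
  (h I le_rfl).inHorn hj

lemma OneSided.inHorn_quad (h₀ : 0 < k) (h₁ : k < Fin.last m) (hI : OneSided k I) (h : J ≤ I) :
    InHorn k (quadHom h) :=
  let ⟨_, hj, h'⟩ := hI.exists_avoids h₀ h₁
  (h' I le_rfl).inHorn_quad (h' J h) hj h

lemma InHorn.exists_avoids (h : InHorn k (edgeHom I)) : ∃ j, j ≠ k ∧ Avoids j I :=
  let ⟨j, hj, h⟩ := h
  ⟨j, hj, h 0, h 1⟩

/-- A value on the interval `I` for a filler of an inner horn: it is prescribed if the endpoints
of `I` together with `k` span a simplex of the horn, and a pullback otherwise. -/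
structure FillerValue (h₀ : 0 < k) (h₁ : k < Fin.last m)
    (I : NonemptyInterval (Fin (m + 1))) where
  /-- the object -/
  obj : C
  obj_eq (hI : InHorn k (edgeHom I)) : obj = hornObj σ I hI
  /-- the projection to the part up to `k` -/
  lower (h : I.fst ≤ k) : obj ⟶ hornObj σ (lowerPart I h) ((oneSided_lowerPart h).inHorn h₀ h₁)
  /-- the projection to the part from `k` on -/
  upper (h : k ≤ I.snd) : obj ⟶ hornObj σ (upperPart I h) ((oneSided_upperPart h).inHorn h₀ h₁)
  lower_eq (h : I.fst ≤ k) (hI : InHorn k (edgeHom I)) (hIJ : InHorn k (quadHom (lowerPart_le h))) :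
    lower h = eqToHom (obj_eq hI) ≫ hornMap σ (lowerPart_le h) hIJ hI _
  upper_eq (h : k ≤ I.snd) (hI : InHorn k (edgeHom I)) (hIJ : InHorn k (quadHom (upperPart_le h))) :
    upper h = eqToHom (obj_eq hI) ≫ hornMap σ (upperPart_le h) hIJ hI _
  isPullback (h : I.fst ≤ k) (h' : k ≤ I.snd) : IsPullback (lower h) (upper h')
    (hornMap σ (pure_le_lowerPart h h') ((oneSided_lowerPart h).inHorn_quad h₀ h₁ _)
      ((oneSided_lowerPart h).inHorn h₀ h₁) (OneSided.inHorn h₀ h₁ (Or.inl le_rfl)))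
    (hornMap σ (pure_le_upperPart h h') ((oneSided_upperPart h').inHorn_quad h₀ h₁ _)
      ((oneSided_upperPart h').inHorn h₀ h₁) (OneSided.inHorn h₀ h₁ (Or.inl le_rfl)))

lemma nonempty_fillerValue [HasPullbacks C] (h₀ : 0 < k) (h₁ : k < Fin.last m)
    (I : NonemptyInterval (Fin (m + 1))) : Nonempty (FillerValue σ h₀ h₁ I) := by
  by_cases hI : InHorn k (edgeHom I)
  · have hI' := hI
    obtain ⟨j, hj, hjI⟩ := hI'.exists_avoids
    exact ⟨{
      obj := hornObj σ I hI
      obj_eq _ := rfl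
      lower h := hornMap σ (lowerPart_le h) (hjI.inHorn_quad (hjI.lowerPart hj h) hj _) hI _
      upper h := hornMap σ (upperPart_le h) (hjI.inHorn_quad (hjI.upperPart hj h) hj _) hI _
      lower_eq _ _ _ := by simp
      upper_eq _ _ _ := by simp
      isPullback h h' := isPullback_hornMap_parts σ hj hjI h h' }⟩
  -- Here the endpoints of `I` and `k` exhaust the vertices, which happens only for `m = 2` and `I =
  -- [0,2]`.
  · have hI' : ¬ OneSided k I := fun h => hI (h.inHorn h₀ h₁)
    simp only [OneSided, not_or, not_le] at hI'
    exact ⟨{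
      obj := pullback
        (hornMap σ (pure_le_lowerPart hI'.2.le hI'.1.le)
          ((oneSided_lowerPart _).inHorn_quad h₀ h₁ _)
          ((oneSided_lowerPart _).inHorn h₀ h₁) (OneSided.inHorn h₀ h₁ (Or.inl le_rfl)))
        (hornMap σ (pure_le_upperPart hI'.2.le hI'.1.le)
          ((oneSided_upperPart _).inHorn_quad h₀ h₁ _)
          ((oneSided_upperPart _).inHorn h₀ h₁) (OneSided.inHorn h₀ h₁ (Or.inl le_rfl)))
      obj_eq h := (hI h).elim
      lower _ := pullback.fst _ _
      upper _ := pullback.snd _ _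
      lower_eq _ h := (hI h).elim
      upper_eq _ h := (hI h).elim
      isPullback _ _ := IsPullback.of_hasPullback _ _ }⟩

section

variable {σ} {h₀ : 0 < k} {h₁ : k < Fin.last m} (V : ∀ I, FillerValue σ h₀ h₁ I)

/-- The gluing data of an inner horn. -/
def fillerGlueData : GlueData C m k where
  obj I := (V I).obj
  side {I J} h hI := eqToHom ((V I).obj_eq (hI.inHorn h₀ h₁)) ≫
    hornMap σ h (hI.inHorn_quad h₀ h₁ h) (hI.inHorn h₀ h₁) ((hI.mono h).inHorn h₀ h₁) ≫
      eqToHom ((V J).obj_eq ((hI.mono h).inHorn h₀ h₁)).symm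
  lower I h := (V I).lower h ≫ eqToHom ((V _).obj_eq _).symm
  upper I h := (V I).upper h ≫ eqToHom ((V _).obj_eq _).symm
  side_self {I} hI := by
    obtain ⟨j, hj, h⟩ := hI.exists_avoids h₀ h₁
    rw [hornMap_self σ hj (h I le_rfl)]
    simp
  side_comp {I J K} h h' hI := by
    obtain ⟨j, hj, hjI⟩ := hI.exists_avoids h₀ h₁
    rw [← hornMap_comp σ hj (hjI I le_rfl) (hjI J h) (hjI K (h'.trans h)) h h'
      (hI.inHorn_quad h₀ h₁ h) ((hI.mono h).inHorn_quad h₀ h₁ h') _ (hI.inHorn h₀ h₁)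
      ((hI.mono h).inHorn h₀ h₁)]
    simp
  lower_eq {I} hI h := by
    rw [(V I).lower_eq h (hI.inHorn h₀ h₁) (hI.inHorn_quad h₀ h₁ _), Category.assoc]
  upper_eq {I} hI h := by
    rw [(V I).upper_eq h (hI.inHorn h₀ h₁) (hI.inHorn_quad h₀ h₁ _), Category.assoc]
  isPullback_of_lt I h h' := by
    simpa using isPullback_eqToHom ((V I).isPullback h.le h'.le) rfl
      ((V _).obj_eq _).symm ((V _).obj_eq _).symm ((V _).obj_eq _).symm
  isPullback_side {a b c} hab hbc hac := by
    obtain ⟨j, hj, h⟩ := hac.exists_avoids h₀ h₁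
    have ha := (h _ le_rfl).1
    have hc := (h _ le_rfl).2
    have hb := (h (interval hab) ⟨le_rfl, hbc⟩).2
    exact isPullback_eqToHom (isPullback_hornMap σ hj hab hbc ha hb hc)
      ((V _).obj_eq _).symm ((V _).obj_eq _).symm ((V _).obj_eq _).symm ((V _).obj_eq _).symm

/-- The intervals may contain `k` in their interior. The map prescribed by the horn is compatible
with the projections, by `hornMap_comp` in the face opposite to `j`, and compatible maps are unique.
-/
lemma fillerGlueData_functor_map (hj : j ≠ k) (hI : Avoids j I) (hJ : Avoids j J) (h : J ≤ I) :
    (fillerGlueData V).functor.map (incl h) =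
      eqToHom ((V I).obj_eq (hI.inHorn hj)) ≫
        hornMap σ h (hI.inHorn_quad hJ hj h) (hI.inHorn hj) (hJ.inHorn hj) ≫
          eqToHom ((V J).obj_eq (hJ.inHorn hj)).symm := by
  apply GlueData.Compatible.map_eq
  constructor
  · intro h'
    have hI' := hI.lowerPart hj (h.1.trans h')
    have hJ' := hJ.lowerPart hj h'
    simp only [fillerGlueData, (V J).lower_eq h' (hJ.inHorn hj) (hJ.inHorn_quad hJ' hj _),
      (V I).lower_eq (h.1.trans h') (hI.inHorn hj) (hI.inHorn_quad hI' hj _), Category.assoc,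
      eqToHom_trans_assoc, eqToHom_refl, Category.id_comp]
    rw [← Category.assoc (hornMap ..), ← Category.assoc (hornMap ..),
      hornMap_comp σ hj hI hJ hJ' h (lowerPart_le h') _ _
        (hI.inHorn_quad hJ' hj _),
      hornMap_comp σ hj hI hI' hJ' (lowerPart_le _) (lowerPart_mono h h') _ _
        (hI.inHorn_quad hJ' hj _)]
  · intro h'
    have hI' := hI.upperPart hj (h'.trans h.2)
    have hJ' := hJ.upperPart hj h'
    simp only [fillerGlueData, (V J).upper_eq h' (hJ.inHorn hj) (hJ.inHorn_quad hJ' hj _),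
      (V I).upper_eq (h'.trans h.2) (hI.inHorn hj) (hI.inHorn_quad hI' hj _), Category.assoc,
      eqToHom_trans_assoc, eqToHom_refl, Category.id_comp]
    rw [← Category.assoc (hornMap ..), ← Category.assoc (hornMap ..),
      hornMap_comp σ hj hI hJ hJ' h (upperPart_le h') _ _
        (hI.inHorn_quad hJ' hj _),
      hornMap_comp σ hj hI hI' hJ' (upperPart_le _) (upperPart_mono h h') _ _
        (hI.inHorn_quad hJ' hj _)]

lemma map_comp_fillerGlueData_functor {n : ℕ} (τ : Fin (n + 1) →o Fin (m + 1))
    (h : InHorn k τ) :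
    IntervalPoset.map τ ⋙ (fillerGlueData V).functor = hornFunctor σ τ h := by
  have h' := h
  obtain ⟨j, hj, hτ⟩ := h'
  have hA (A : NonemptyInterval (Fin (n + 1))) : Avoids j (A.map τ) := ⟨hτ _, hτ _⟩
  refine CategoryTheory.Functor.ext (fun A => ((V _).obj_eq ((hA (ofDual A)).inHorn hj)).trans
    (hornFunctor_obj σ τ h _ _).symm) fun A B f => ?_
  have hBA : ofDual B ≤ ofDual A := leOfHom f
  have e := fillerGlueData_functor_map V hj (hA (ofDual A)) (hA (ofDual B))
    ⟨τ.monotone hBA.1, τ.monotone hBA.2⟩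
  rw [hornMap_map σ τ h hBA] at e
  exact eq_of_eqToHom_conj e

end

theorem exists_filler [HasPullbacks C] (h₀ : 0 < k) (h₁ : k < Fin.last m) :
    ∃ σ' : (Δ[m] : SSet.{max u v}) ⟶ SpanSSet C, Λ[m, k].ι ≫ σ' = σ := by
  have V := fun I => (nonempty_fillerValue σ h₀ h₁ I).some
  refine ⟨SSet.yonedaEquiv.symm
    (⟨(fillerGlueData V).functor, (fillerGlueData V).pullbackProperty_functor⟩ :
      { F : IntervalPoset m ⥤ C // PullbackProperty F }), ?_⟩
  ext n ⟨x, hx⟩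
  obtain ⟨n⟩ := n
  induction n using SimplexCategory.rec with | _ n
  obtain ⟨τ, rfl⟩ := SSet.stdSimplex.objMk_bijective.2 x
  exact Subtype.ext (map_comp_fillerGlueData_functor V τ ((inHorn_iff k τ).2 hx))

end HornFilling

/-! ### Uniqueness of fillers in dimension at least three. -/

section Uniqueness

variable {C : Type u} [Category.{v} C]

open IntervalPoset OrderDual

variable {m : ℕ} {k : Fin (m + 1)}

lemma exists_ne_and_avoids (hm : 2 < m) (k : Fin (m + 1))
    (I : NonemptyInterval (Fin (m + 1))) : ∃ j, j ≠ k ∧ Avoids j I := by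
  by_contra! h
  have h' : (Finset.univ : Finset (Fin (m + 1))) ⊆ {k, I.fst, I.snd} := fun j _ => by
    have := h j
    simp only [Avoids, Finset.mem_insert, Finset.mem_singleton] at this ⊢
    grind
  have := (Finset.card_le_card h').trans Finset.card_le_three
  simp at this
  omega

variable {F F' : IntervalPoset m ⥤ C}

lemma functor_obj_eq (h : ∀ {n : ℕ} (τ : Fin (n + 1) →o Fin (m + 1)), InHorn k τ →
      IntervalPoset.map τ ⋙ F = IntervalPoset.map τ ⋙ F')
    {I : NonemptyInterval (Fin (m + 1))} (hI : InHorn k (edgeHom I)) :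
    F.obj (toDual I) = F'.obj (toDual I) :=
  Functor.congr_obj (h _ hI) (toDual edgeInterval)

lemma functor_map_eq (h : ∀ {n : ℕ} (τ : Fin (n + 1) →o Fin (m + 1)), InHorn k τ →
      IntervalPoset.map τ ⋙ F = IntervalPoset.map τ ⋙ F')
    {I J : NonemptyInterval (Fin (m + 1))} (hJI : J ≤ I) (hIJ : InHorn k (quadHom hJI))
    (hI : F.obj (toDual I) = F'.obj (toDual I)) (hJ : F.obj (toDual J) = F'.obj (toDual J)) :
    F.map (incl hJI) ≫ eqToHom hJ = eqToHom hI ≫ F'.map (incl hJI) := by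
  have e : F.map (incl hJI) = eqToHom hI ≫ F'.map (incl hJI) ≫ eqToHom hJ.symm :=
    Functor.congr_hom (h _ hIJ)
      (incl midInterval_le : toDual outerInterval ⟶ toDual midInterval)
  simp [e]

/-- A functor with the pullback property is determined by its restriction to an inner horn of
dimension at least three. -/
theorem functor_eq_of_restriction_eq (hm : 2 < m) (h₀ : 0 < k) (h₁ : k < Fin.last m)
    (hF' : PullbackProperty F')
    (h : ∀ {n : ℕ} (τ : Fin (n + 1) →o Fin (m + 1)), InHorn k τ →
      IntervalPoset.map τ ⋙ F = IntervalPoset.map τ ⋙ F') : F = F' := by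
  have hobj (I : NonemptyInterval (Fin (m + 1))) : F.obj (toDual I) = F'.obj (toDual I) :=
    let ⟨_, hj, hI⟩ := exists_ne_and_avoids hm k I
    functor_obj_eq h (hI.inHorn hj)
  have comp {I J K : NonemptyInterval (Fin (m + 1))} (hJI : J ≤ I) (hKJ : K ≤ J)
      (e₁ : F.map (incl hJI) ≫ eqToHom (hobj J) = eqToHom (hobj I) ≫ F'.map (incl hJI))
      (e₂ : F.map (incl hKJ) ≫ eqToHom (hobj K) = eqToHom (hobj J) ≫ F'.map (incl hKJ)) :
      F.map (incl (hKJ.trans hJI)) ≫ eqToHom (hobj K) =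
        eqToHom (hobj I) ≫ F'.map (incl (hKJ.trans hJI)) := by
    rw [← map_incl_comp F hJI hKJ, Category.assoc, e₂, ← Category.assoc, e₁, Category.assoc,
      map_incl_comp]
  have side {I J : NonemptyInterval (Fin (m + 1))} (hJI : J ≤ I) (hI : OneSided k I) :
      F.map (incl hJI) ≫ eqToHom (hobj J) = eqToHom (hobj I) ≫ F'.map (incl hJI) :=
    functor_map_eq h hJI (hI.inHorn_quad h₀ h₁ hJI) _ _
  -- The map factors through the part of `I` on the side of `J`. The first factor involves only the
  -- endpoints of `I` and `k`, hence lies in the horn; the second starts from a one-sided interval.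
  have toSide {I J : NonemptyInterval (Fin (m + 1))} (hJI : J ≤ I) (hJ : OneSided k J) :
      F.map (incl hJI) ≫ eqToHom (hobj J) = eqToHom (hobj I) ≫ F'.map (incl hJI) := by
    obtain ⟨j, hj, hjI⟩ := exists_ne_and_avoids hm k I
    rcases hJ with hJ | hJ
    · have hI : I.fst ≤ k := hJI.1.trans (J.fst_le_snd.trans hJ)
      exact comp (lowerPart_le hI) (le_lowerPart hJI hI hJ)
        (functor_map_eq h _ (hjI.inHorn_quad (hjI.lowerPart hj hI) hj _) _ _)
        (side _ (oneSided_lowerPart _))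
    · have hI : k ≤ I.snd := (hJ.trans J.fst_le_snd).trans hJI.2
      exact comp (upperPart_le hI) (le_upperPart hJI hI hJ)
        (functor_map_eq h _ (hjI.inHorn_quad (hjI.upperPart hj hI) hj _) _ _)
        (side _ (oneSided_upperPart _))
  have all {I J : NonemptyInterval (Fin (m + 1))} (hJI : J ≤ I) :
      F.map (incl hJI) ≫ eqToHom (hobj J) = eqToHom (hobj I) ≫ F'.map (incl hJI) := by
    by_cases hJ : OneSided k J
    · exact toSide hJI hJ
    · simp only [OneSided, not_or, not_le] at hJ
      -- The projections from `F' J` to its parts on the two sides of `k` are jointly monic, and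
      -- composing with them reduces to one-sided targets.
      have proj {K : NonemptyInterval (Fin (m + 1))} (hKJ : K ≤ J) (hK : OneSided k K) :
          (F.map (incl hJI) ≫ eqToHom (hobj J)) ≫ F'.map (incl hKJ) =
            (eqToHom (hobj I) ≫ F'.map (incl hJI)) ≫ F'.map (incl hKJ) := by
        rw [Category.assoc, ← toSide hKJ hK, ← Category.assoc, map_incl_comp, Category.assoc,
          map_incl_comp, toSide (hKJ.trans hJI) hK]
      exact (hF'.split hJ.2.le hJ.1.le).hom_ext (proj _ (Or.inl le_rfl)) (proj _ (Or.inr le_rfl))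
  refine CategoryTheory.Functor.ext (fun I => hobj (ofDual I)) fun I J f => ?_
  have e := all (leOfHom f : ofDual J ≤ ofDual I)
  rw [← Category.assoc]
  exact (comp_eqToHom_iff _ _ _).1 e

theorem isNOneCategory_spanSSet [HasPullbacks C] : IsNOneCategory 2 (SpanSSet C) where
  quasicategory := ⟨fun _ _ σ h₀ h₁ => (exists_filler σ h₀ h₁).imp fun _ h => h.symm⟩
  existsUnique_filler {m} hm {k} h₀ h₁ σ := by
    obtain ⟨σ', hσ'⟩ := exists_filler σ h₀ h₁
    refine ⟨σ', hσ', fun σ'' hσ'' => SSet.yonedaEquiv.injective (Subtype.ext ?_)⟩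
    refine functor_eq_of_restriction_eq hm h₀ h₁ (SSet.yonedaEquiv σ').2 fun {n} τ hτ => ?_
    have key (ρ : (Δ[m] : SSet.{max u v}) ⟶ SpanSSet C) (hρ : Λ[m, k].ι ≫ ρ = σ) :
        IntervalPoset.map τ ⋙ (SSet.yonedaEquiv ρ).1 = hornFunctor σ τ hτ := by
      subst hρ
      obtain ⟨x, rfl⟩ := SSet.yonedaEquiv.symm.surjective ρ
      rw [Equiv.apply_symm_apply]
      rfl
    exact (key σ'' hσ'').trans (key σ' hσ').symm

end Uniqueness

/-! ### From cells of the nerve to functors on intervals. -/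

section NerveIso

variable {C : Type u} [Category.{v} C] {P : PullbackChoice C}

open IntervalPoset OrderDual

namespace TwoSpan

variable {X Y Z W : TwoSpan P}

@[simp]
lemma comp_iso_hom {S T U : X ⟶ Y} (f : S ⟶ T) (g : T ⟶ U) :
    (f ≫ g).iso.hom = f.iso.hom ≫ g.iso.hom := rfl

@[simp]
lemma whiskerLeft_fst (S : X ⟶ Y) {T T' : Y ⟶ Z} (f : T ⟶ T') :
    (S ◁ f).iso.hom ≫ P.fst S.r T'.l = P.fst S.r T.l :=
  (P.lift_fst ..).trans (Category.comp_id _)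

@[simp]
lemma whiskerLeft_snd (S : X ⟶ Y) {T T' : Y ⟶ Z} (f : T ⟶ T') :
    (S ◁ f).iso.hom ≫ P.snd S.r T'.l = P.snd S.r T.l ≫ f.iso.hom :=
  P.lift_snd ..

@[simp]
lemma whiskerRight_fst {S S' : X ⟶ Y} (f : S ⟶ S') (T : Y ⟶ Z) :
    (f ▷ T).iso.hom ≫ P.fst S'.r T.l = P.fst S.r T.l ≫ f.iso.hom :=
  P.lift_fst ..

@[simp]
lemma whiskerRight_snd {S S' : X ⟶ Y} (f : S ⟶ S') (T : Y ⟶ Z) :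
    (f ▷ T).iso.hom ≫ P.snd S'.r T.l = P.snd S.r T.l :=
  (P.lift_snd ..).trans (Category.comp_id _)

lemma associator_fst (S : W ⟶ X) (T : X ⟶ Y) (U : Y ⟶ Z) :
    (α_ S T U).hom.iso.hom ≫ P.fst S.r (T ≫ U).l =
      P.fst (S ≫ T).r U.l ≫ P.fst S.r T.l :=
  P.lift_fst ..

lemma associator_snd_fst (S : W ⟶ X) (T : X ⟶ Y) (U : Y ⟶ Z) :
    (α_ S T U).hom.iso.hom ≫ P.snd S.r (T ≫ U).l ≫ P.fst T.r U.l =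
      P.fst (S ≫ T).r U.l ≫ P.snd S.r T.l :=
  (P.lift_snd_assoc ..).trans (P.lift_fst ..)

lemma associator_snd_snd (S : W ⟶ X) (T : X ⟶ Y) (U : Y ⟶ Z) :
    (α_ S T U).hom.iso.hom ≫ P.snd S.r (T ≫ U).l ≫ P.snd T.r U.l = P.snd (S ≫ T).r U.l :=
  (P.lift_snd_assoc ..).trans (P.lift_snd ..)

end TwoSpan

namespace NerveCell

variable {n : ℕ} (x : NerveCell (TwoSpan P) n)

variable {i j k l : Fin (n + 1)}

/-- The first projection out of the middle object of a long edge of a 2-simplex. -/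
noncomputable def proj₁ (hij : i ≤ j) (hjk : j ≤ k) : (x.f (hij.trans hjk)).apex ⟶ (x.f hij).apex :=
  (x.θ hij hjk).iso.inv ≫ P.fst (x.f hij).r (x.f hjk).l

/-- The second projection out of the middle object of a long edge of a 2-simplex. -/
noncomputable def proj₂ (hij : i ≤ j) (hjk : j ≤ k) : (x.f (hij.trans hjk)).apex ⟶ (x.f hjk).apex :=
  (x.θ hij hjk).iso.inv ≫ P.snd (x.f hij).r (x.f hjk).l

lemma θ_proj₁ (hij : i ≤ j) (hjk : j ≤ k) :
    (x.θ hij hjk).iso.hom ≫ x.proj₁ hij hjk = P.fst (x.f hij).r (x.f hjk).l :=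
  Iso.hom_inv_id_assoc _ _

lemma θ_proj₂ (hij : i ≤ j) (hjk : j ≤ k) :
    (x.θ hij hjk).iso.hom ≫ x.proj₂ hij hjk = P.snd (x.f hij).r (x.f hjk).l :=
  Iso.hom_inv_id_assoc _ _

lemma θ_proj₁_assoc (hij : i ≤ j) (hjk : j ≤ k) {A : C} (g : (x.f hij).apex ⟶ A) :
    (x.θ hij hjk).iso.hom ≫ x.proj₁ hij hjk ≫ g = P.fst (x.f hij).r (x.f hjk).l ≫ g := by
  rw [← Category.assoc, θ_proj₁]

lemma θ_proj₂_assoc (hij : i ≤ j) (hjk : j ≤ k) {A : C} (g : (x.f hjk).apex ⟶ A) :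
    (x.θ hij hjk).iso.hom ≫ x.proj₂ hij hjk ≫ g = P.snd (x.f hij).r (x.f hjk).l ≫ g := by
  rw [← Category.assoc, θ_proj₂]

lemma proj₁_l (hij : i ≤ j) (hjk : j ≤ k) :
    x.proj₁ hij hjk ≫ (x.f hij).l = (x.f (hij.trans hjk)).l := by
  rw [← cancel_epi (x.θ hij hjk).iso.hom, ← Category.assoc, θ_proj₁]
  exact (x.θ hij hjk).hom_l.symm

lemma proj₂_r (hij : i ≤ j) (hjk : j ≤ k) :
    x.proj₂ hij hjk ≫ (x.f hjk).r = (x.f (hij.trans hjk)).r := by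
  rw [← cancel_epi (x.θ hij hjk).iso.hom, ← Category.assoc, θ_proj₂]
  exact (x.θ hij hjk).hom_r.symm

lemma isPullback_proj (hij : i ≤ j) (hjk : j ≤ k) :
    IsPullback (x.proj₁ hij hjk) (x.proj₂ hij hjk) (x.f hij).r (x.f hjk).l :=
  (P.isPullback _ _).of_iso (x.θ hij hjk).iso (Iso.refl _) (Iso.refl _) (Iso.refl _)
    (by simp [θ_proj₁]) (by simp [θ_proj₂]) (by simp) (by simp)

/-- The normalised `θ` is a right unitor, which for spans is the first projection. -/
lemma proj₁_refl (hij : i ≤ j) : x.proj₁ hij (le_refl j) = 𝟙 _ := by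
  rw [← cancel_epi (x.θ hij (le_refl j)).iso.hom, θ_proj₁, x.θ_self_right]
  exact (TwoSpan.whiskerLeft_fst _ _).symm.trans (Category.comp_id _).symm

lemma proj₂_refl (hij : i ≤ j) : x.proj₂ (le_refl i) hij = 𝟙 _ := by
  rw [← cancel_epi (x.θ (le_refl i) hij).iso.hom, θ_proj₂, x.θ_self_left]
  exact (TwoSpan.whiskerRight_snd _ _).symm.trans (Category.comp_id _).symm

lemma f_self_l (i : Fin (n + 1)) :
    (x.f (le_refl i)).l = eqToHom (congrArg SpanDiagram.apex (x.f_self i)) := by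
  have key {X : TwoSpan P} (S : X ⟶ X) (h : S = 𝟙 X) :
      S.l = eqToHom (congrArg SpanDiagram.apex h) := by
    subst h
    rfl
  exact key _ (x.f_self i)

lemma f_self_r (i : Fin (n + 1)) :
    (x.f (le_refl i)).r = eqToHom (congrArg SpanDiagram.apex (x.f_self i)) := by
  have key {X : TwoSpan P} (S : X ⟶ X) (h : S = 𝟙 X) :
      S.r = eqToHom (congrArg SpanDiagram.apex h) := by
    subst h
    rfl
  exact key _ (x.f_self i)

lemma cocycle (hij : i ≤ j) (hjk : j ≤ k) (hkl : k ≤ l) :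
    (x.θ hij hjk ▷ x.f hkl).iso.hom ≫ (x.θ (hij.trans hjk) hkl).iso.hom =
      (α_ (x.f hij) (x.f hjk) (x.f hkl)).hom.iso.hom ≫ (x.f hij ◁ x.θ hjk hkl).iso.hom ≫
        (x.θ hij (hjk.trans hkl)).iso.hom :=
  congrArg (fun f => f.iso.hom) (x.compatibility hij hjk hkl)

/-- Here and in the next two lemmas, both sides are precomposed with the isomorphism from the
iterated pullback. Written in the two ways given by `cocycle`, it turns them into the same
projection to one of the three factors. -/
lemma proj₁_proj₁ (hij : i ≤ j) (hjk : j ≤ k) (hkl : k ≤ l) :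
    x.proj₁ (hij.trans hjk) hkl ≫ x.proj₁ hij hjk = x.proj₁ hij (hjk.trans hkl) := by
  rw [← cancel_epi ((x.θ hij hjk ▷ x.f hkl).iso.hom ≫ (x.θ (hij.trans hjk) hkl).iso.hom)]
  conv_rhs => rw [cocycle]
  simp only [Category.assoc, θ_proj₁, θ_proj₁_assoc, TwoSpan.whiskerLeft_fst,
    TwoSpan.associator_fst]
  rw [← Category.assoc, TwoSpan.whiskerRight_fst, Category.assoc, θ_proj₁]

lemma proj₁_proj₂ (hij : i ≤ j) (hjk : j ≤ k) (hkl : k ≤ l) :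
    x.proj₁ (hij.trans hjk) hkl ≫ x.proj₂ hij hjk =
      x.proj₂ hij (hjk.trans hkl) ≫ x.proj₁ hjk hkl := by
  rw [← cancel_epi ((x.θ hij hjk ▷ x.f hkl).iso.hom ≫ (x.θ (hij.trans hjk) hkl).iso.hom)]
  conv_rhs => rw [cocycle]
  simp only [Category.assoc, θ_proj₁_assoc, θ_proj₂_assoc]
  rw [← Category.assoc, TwoSpan.whiskerRight_fst, Category.assoc, θ_proj₂,
    ← Category.assoc (x.f hij ◁ x.θ hjk hkl).iso.hom, TwoSpan.whiskerLeft_snd, Category.assoc,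
    θ_proj₁, TwoSpan.associator_snd_fst]

lemma proj₂_proj₂ (hij : i ≤ j) (hjk : j ≤ k) (hkl : k ≤ l) :
    x.proj₂ hij (hjk.trans hkl) ≫ x.proj₂ hjk hkl = x.proj₂ (hij.trans hjk) hkl := by
  rw [← cancel_epi ((x.θ hij hjk ▷ x.f hkl).iso.hom ≫ (x.θ (hij.trans hjk) hkl).iso.hom)]
  conv_lhs => rw [cocycle]
  simp only [Category.assoc, θ_proj₂_assoc, θ_proj₂, TwoSpan.whiskerRight_snd]
  rw [← Category.assoc (x.f hij ◁ x.θ hjk hkl).iso.hom, TwoSpan.whiskerLeft_snd, Category.assoc,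
    θ_proj₂, TwoSpan.associator_snd_snd]

/-- A restriction shortens an interval on the right, then on the left. In a composite, `proj₁_proj₂`
interchanges the two middle steps, and steps on the same side merge. -/
lemma proj_comp {i' i'' k' k'' : Fin (n + 1)} (hi : i ≤ i') (hi' : i' ≤ i'') (h : i'' ≤ k'')
    (hk' : k'' ≤ k') (hk : k' ≤ k) :
    x.proj₁ (hi.trans (hi'.trans h)) (hk'.trans hk) ≫ x.proj₂ (hi.trans hi') h =
      (x.proj₁ (hi.trans (hi'.trans (h.trans hk'))) hk ≫ x.proj₂ hi (hi'.trans (h.trans hk'))) ≫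
        x.proj₁ (hi'.trans h) hk' ≫ x.proj₂ hi' h := by
  rw [← x.proj₁_proj₁ (hi.trans (hi'.trans h)) hk' hk, ← x.proj₂_proj₂ hi hi' h, Category.assoc,
    Category.assoc, ← Category.assoc (x.proj₁ _ hk'), x.proj₁_proj₂ hi (hi'.trans h) hk',
    Category.assoc]

/-- The functor on intervals given by a cell of the nerve. -/
noncomputable def toFunctor : IntervalPoset n ⥤ C where
  obj I := (x.f (ofDual I).fst_le_snd).apex
  map {_ J} h := x.proj₁ ((leOfHom h).1.trans (ofDual J).fst_le_snd) (leOfHom h).2 ≫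
    x.proj₂ (leOfHom h).1 (ofDual J).fst_le_snd
  map_id _ := (congrArg₂ _ (x.proj₁_refl _) (x.proj₂_refl _)).trans (Category.comp_id _)
  map_comp {_ _ K} h h' := x.proj_comp (leOfHom h).1 (leOfHom h').1 (ofDual K).fst_le_snd
    (leOfHom h').2 (leOfHom h).2

lemma toFunctor_map_proj₁ (hij : i ≤ j) (hjk : j ≤ k) :
    x.toFunctor.map (incl (I := interval hij) (U := interval (hij.trans hjk)) ⟨le_rfl, hjk⟩) =
      x.proj₁ hij hjk :=
  (congrArg (fun t => x.proj₁ hij hjk ≫ t) (x.proj₂_refl hij)).trans (Category.comp_id _)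

lemma toFunctor_map_proj₂ (hij : i ≤ j) (hjk : j ≤ k) :
    x.toFunctor.map (incl (I := interval hjk) (U := interval (hij.trans hjk)) ⟨hij, le_rfl⟩) =
      x.proj₂ hij hjk :=
  (congrArg (fun t => t ≫ x.proj₂ hij hjk) (x.proj₁_refl (hij.trans hjk))).trans
    (Category.id_comp _)

lemma proj₁_eq_l (hij : i ≤ j) : x.proj₁ (le_refl i) hij =
    (x.f hij).l ≫ eqToHom (congrArg SpanDiagram.apex (x.f_self i)).symm := by
  have := x.proj₁_l (le_refl i) hij
  rw [f_self_l] at this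
  exact (comp_eqToHom_iff _ _ _).1 this

lemma proj₂_eq_r (hij : i ≤ j) : x.proj₂ hij (le_refl j) =
    (x.f hij).r ≫ eqToHom (congrArg SpanDiagram.apex (x.f_self j)).symm := by
  have := x.proj₂_r hij (le_refl j)
  rw [f_self_r] at this
  exact (comp_eqToHom_iff _ _ _).1 this

/-- The squares to check are those of `isPullback_proj`, once the apex of `f j j` is identified with
`X j`. -/
lemma pullbackProperty_toFunctor : PullbackProperty x.toFunctor := by
  refine pullbackProperty_of_split fun {i j k} hij hjk => ?_
  rw [x.toFunctor_map_proj₁ hij hjk, x.toFunctor_map_proj₂ hij hjk,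
    x.toFunctor_map_proj₂ hij (le_refl j), x.toFunctor_map_proj₁ (le_refl j) hjk,
    proj₁_eq_l, proj₂_eq_r]
  exact (x.isPullback_proj hij hjk).of_iso (Iso.refl _) (Iso.refl _) (Iso.refl _)
    (eqToIso (congrArg SpanDiagram.apex (x.f_self j)).symm)
    ((Category.comp_id _).trans (Category.id_comp _).symm)
    ((Category.comp_id _).trans (Category.id_comp _).symm)
    (Category.id_comp _).symm (Category.id_comp _).symm

end NerveCell

end NerveIso

/-! ### From functors back to cells of the nerve, and the isomorphism. -/

section NerveIso

variable {C : Type u} [Category.{v} C] {P : PullbackChoice C}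

open IntervalPoset OrderDual

lemma SpanDiagram.ext_of_eqToHom {X Y : C} {S T : SpanDiagram X Y} (h : S.apex = T.apex)
    (hl : S.l = eqToHom h ≫ T.l) (hr : S.r = eqToHom h ≫ T.r) : S = T := by
  obtain ⟨A, l, r⟩ := S
  obtain ⟨A', l', r'⟩ := T
  obtain rfl : A = A' := h
  obtain rfl : l = l' := by simpa using hl
  obtain rfl : r = r' := by simpa using hr
  rfl

lemma NerveCell.ext_of_proj {n : ℕ} {x y : NerveCell (TwoSpan P) n}
    (hX : ∀ i, (x.X i).as = (y.X i).as)
    (hf : ∀ {i j : Fin (n + 1)} (hij : i ≤ j), (x.f hij).apex = (y.f hij).apex)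
    (hl : ∀ {i j : Fin (n + 1)} (hij : i ≤ j),
      (x.f hij).l ≫ eqToHom (hX i) = eqToHom (hf hij) ≫ (y.f hij).l)
    (hr : ∀ {i j : Fin (n + 1)} (hij : i ≤ j),
      (x.f hij).r ≫ eqToHom (hX j) = eqToHom (hf hij) ≫ (y.f hij).r)
    (h₁ : ∀ {i j k : Fin (n + 1)} (hij : i ≤ j) (hjk : j ≤ k),
      x.proj₁ hij hjk ≫ eqToHom (hf hij) = eqToHom (hf (hij.trans hjk)) ≫ y.proj₁ hij hjk)
    (h₂ : ∀ {i j k : Fin (n + 1)} (hij : i ≤ j) (hjk : j ≤ k),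
      x.proj₂ hij hjk ≫ eqToHom (hf hjk) = eqToHom (hf (hij.trans hjk)) ≫ y.proj₂ hij hjk) :
    x = y := by
  obtain ⟨X, f, θ, _, _, _, _⟩ := x
  obtain ⟨X', f', θ', _, _, _, _⟩ := y
  obtain rfl : X = X' := funext fun i => congrArg TwoSpan.mk (hX i)
  obtain rfl : @f = @f' := by
    funext i j hij
    exact SpanDiagram.ext_of_eqToHom (hf hij) (by simpa using hl hij) (by simpa using hr hij)
  obtain rfl : @θ = @θ' := by
    funext i j k hij hjk
    have e₁ : (θ hij hjk).iso.inv ≫ P.fst _ _ = (θ' hij hjk).iso.inv ≫ P.fst _ _ := by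
      simpa [proj₁] using h₁ hij hjk
    have e₂ : (θ hij hjk).iso.inv ≫ P.snd _ _ = (θ' hij hjk).iso.inv ≫ P.snd _ _ := by
      simpa [proj₂] using h₂ hij hjk
    refine TwoSpan.hom₂_ext ?_
    -- The inverses map into the chosen pullback, so they can be compared by projections.
    rw [← Iso.inv_eq_inv]
    exact P.hom_ext e₁ e₂
  rfl

lemma map_comp_eqToHom {D : Type*} [Category* D] {F G : D ⥤ C} (h : F = G) {X Y : D} (f : X ⟶ Y) :
    F.map f ≫ eqToHom (Functor.congr_obj h Y) = eqToHom (Functor.congr_obj h X) ≫ G.map f := by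
  subst h
  simp

lemma comp_eqToHom_eq_of_comp_eqToHom {A B X X' Y Y' : C} {f : A ⟶ X} {g : B ⟶ Y} {e₁ : X = X'}
    {e₂ : X' = Y'} {e₃ : A = B} {e₄ : Y = Y'}
    (h : (f ≫ eqToHom e₁) ≫ eqToHom e₂ = eqToHom e₃ ≫ g ≫ eqToHom e₄) :
    f ≫ eqToHom (e₁.trans (e₂.trans e₄.symm)) = eqToHom e₃ ≫ g := by
  subst e₁ e₂ e₃ e₄
  simpa using h

lemma NerveCell.toFunctor_injective {n : ℕ} :
    Function.Injective (NerveCell.toFunctor (P := P) (n := n)) := by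
  intro x y h
  have hf {i j : Fin (n + 1)} (hij : i ≤ j) : (x.f hij).apex = (y.f hij).apex :=
    Functor.congr_obj h (toDual (interval hij))
  have hX (i : Fin (n + 1)) : (x.X i).as = (y.X i).as :=
    (congrArg SpanDiagram.apex (x.f_self i)).symm.trans
      ((hf (le_refl i)).trans (congrArg SpanDiagram.apex (y.f_self i)))
  have h₁ {i j k : Fin (n + 1)} (hij : i ≤ j) (hjk : j ≤ k) :
      x.proj₁ hij hjk ≫ eqToHom (hf hij) = eqToHom (hf (hij.trans hjk)) ≫ y.proj₁ hij hjk := by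
    have e := map_comp_eqToHom h
      (incl (I := interval hij) (U := interval (hij.trans hjk)) ⟨le_rfl, hjk⟩)
    rwa [x.toFunctor_map_proj₁ hij hjk, y.toFunctor_map_proj₁ hij hjk] at e
  have h₂ {i j k : Fin (n + 1)} (hij : i ≤ j) (hjk : j ≤ k) :
      x.proj₂ hij hjk ≫ eqToHom (hf hjk) = eqToHom (hf (hij.trans hjk)) ≫ y.proj₂ hij hjk := by
    have e := map_comp_eqToHom h
      (incl (I := interval hjk) (U := interval (hij.trans hjk)) ⟨hij, le_rfl⟩)
    rwa [x.toFunctor_map_proj₂ hij hjk, y.toFunctor_map_proj₂ hij hjk] at e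
  refine NerveCell.ext_of_proj hX hf (fun {i j} hij => ?_) (fun {i j} hij => ?_) h₁ h₂
  · have e := h₁ (le_refl i) hij
    rw [proj₁_eq_l, proj₁_eq_l] at e
    exact comp_eqToHom_eq_of_comp_eqToHom e
  · have e := h₂ hij (le_refl j)
    rw [proj₂_eq_r, proj₂_eq_r] at e
    exact comp_eqToHom_eq_of_comp_eqToHom e

section OfFunctor

variable {n : ℕ} {F : IntervalPoset n ⥤ C} (hF : PullbackProperty F)
  {i j k l : Fin (n + 1)}

/-- The value of a functor with the pullback property on a long interval, as a chosen pullback. -/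
noncomputable def splitIso (P : PullbackChoice C) (hij : i ≤ j) (hjk : j ≤ k) :
    P.obj (F.map (incl (I := interval (le_refl j)) (U := interval hij) ⟨hij, le_rfl⟩))
        (F.map (incl (I := interval (le_refl j)) (U := interval hjk) ⟨le_rfl, hjk⟩)) ≅
      F.obj (toDual (interval (hij.trans hjk))) :=
  (P.isPullback _ _).isoIsPullback _ _ (hF.split hij hjk)

lemma splitIso_fst (hij : i ≤ j) (hjk : j ≤ k) :
    (splitIso hF P hij hjk).hom ≫
      F.map (incl (I := interval hij) (U := interval (hij.trans hjk)) ⟨le_rfl, hjk⟩) =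
        P.fst _ _ :=
  IsPullback.isoIsPullback_hom_fst ..

lemma splitIso_snd (hij : i ≤ j) (hjk : j ≤ k) :
    (splitIso hF P hij hjk).hom ≫
      F.map (incl (I := interval hjk) (U := interval (hij.trans hjk)) ⟨hij, le_rfl⟩) =
        P.snd _ _ :=
  IsPullback.isoIsPullback_hom_snd ..

variable (F) in
/-- The span given by an interval. -/
abbrev spanOf (P : PullbackChoice C) (hij : i ≤ j) :
    (⟨F.obj (toDual (interval (le_refl i)))⟩ : TwoSpan P) ⟶
      ⟨F.obj (toDual (interval (le_refl j)))⟩ :=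
  ({ apex := F.obj (toDual (interval hij))
     l := F.map (incl (I := interval (le_refl i)) ⟨le_rfl, hij⟩)
     r := F.map (incl (I := interval (le_refl j)) ⟨hij, le_rfl⟩) } : SpanDiagram _ _)

/-- The 2-cell given by a decomposition of an interval. -/
noncomputable abbrev splitHom (P : PullbackChoice C) (hij : i ≤ j) (hjk : j ≤ k) :
    spanOf F P hij ≫ spanOf F P hjk ⟶ spanOf F P (hij.trans hjk) :=
  SpanDiagram.Hom.mk (splitIso hF P hij hjk)
    (by
      have := splitIso_fst (P := P) hF hij hjk =≫
        F.map (incl (I := interval (le_refl i)) ⟨le_rfl, hij⟩)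
      rwa [Category.assoc, map_incl_comp] at this)
    (by
      have := splitIso_snd (P := P) hF hij hjk =≫
        F.map (incl (I := interval (le_refl k)) ⟨hjk, le_rfl⟩)
      rwa [Category.assoc, map_incl_comp] at this)

lemma splitHom_fst (hij : i ≤ j) (hjk : j ≤ k) :
    (splitHom hF P hij hjk).iso.hom ≫
      F.map (incl (I := interval hij) (U := interval (hij.trans hjk)) ⟨le_rfl, hjk⟩) =
        P.fst (spanOf F P hij).r (spanOf F P hjk).l :=
  splitIso_fst hF hij hjk

lemma splitHom_snd (hij : i ≤ j) (hjk : j ≤ k) :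
    (splitHom hF P hij hjk).iso.hom ≫
      F.map (incl (I := interval hjk) (U := interval (hij.trans hjk)) ⟨hij, le_rfl⟩) =
        P.snd (spanOf F P hij).r (spanOf F P hjk).l :=
  splitIso_snd hF hij hjk

/-- Maps into `F[i,l]` are detected on `F[i,j]`, `F[j,k]` and `F[k,l]`, by cutting at `j` and then
at `k`; on each, both sides are the evident projection. -/
lemma splitHom_cocycle (hij : i ≤ j) (hjk : j ≤ k) (hkl : k ≤ l) :
    splitHom hF P hij hjk ▷ spanOf F P hkl ≫ splitHom hF P (hij.trans hjk) hkl =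
      (α_ (spanOf F P hij) (spanOf F P hjk) (spanOf F P hkl)).hom ≫
        spanOf F P hij ◁ splitHom hF P hjk hkl ≫ splitHom hF P hij (hjk.trans hkl) := by
  have hil := hij.trans (hjk.trans hkl)
  have c₁ : F.map (incl (I := interval hij) (U := interval hil) ⟨le_rfl, hjk.trans hkl⟩) =
      F.map (incl (I := interval (hij.trans hjk)) (U := interval hil) ⟨le_rfl, hkl⟩) ≫
        F.map (incl (I := interval hij) ⟨le_rfl, hjk⟩) := (map_incl_comp F _ _).symm
  have c₂ : F.map (incl (I := interval (hjk.trans hkl)) (U := interval hil) ⟨hij, le_rfl⟩) ≫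
      F.map (incl (I := interval hjk) ⟨le_rfl, hkl⟩) =
        F.map (incl (I := interval (hij.trans hjk)) (U := interval hil) ⟨le_rfl, hkl⟩) ≫
          F.map (incl (I := interval hjk) ⟨hij, le_rfl⟩) := by simp only [map_incl_comp]
  have c₃ : F.map (incl (I := interval (hjk.trans hkl)) (U := interval hil) ⟨hij, le_rfl⟩) ≫
      F.map (incl (I := interval hkl) ⟨hjk, le_rfl⟩) =
        F.map (incl (I := interval hkl) (U := interval hil) ⟨hij.trans hjk, le_rfl⟩) :=
    map_incl_comp F _ _
  refine TwoSpan.hom₂_ext ((hF.split hij (hjk.trans hkl)).hom_ext ?_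
    ((hF.split hjk hkl).hom_ext ?_ ?_))
  · simp only [TwoSpan.comp_iso_hom, Category.assoc]
    rw [splitHom_fst hF hij (hjk.trans hkl), c₁, TwoSpan.whiskerLeft_fst, TwoSpan.associator_fst,
      ← Category.assoc (splitHom hF P (hij.trans hjk) hkl).iso.hom, splitHom_fst,
      ← Category.assoc, TwoSpan.whiskerRight_fst, Category.assoc, splitHom_fst]
  · simp only [TwoSpan.comp_iso_hom, Category.assoc]
    rw [← Category.assoc (splitHom hF P hij (hjk.trans hkl)).iso.hom,
      splitHom_snd hF hij (hjk.trans hkl),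
      ← Category.assoc (spanOf F P hij ◁ splitHom hF P hjk hkl).iso.hom, TwoSpan.whiskerLeft_snd,
      Category.assoc, splitHom_fst, TwoSpan.associator_snd_fst, c₂,
      ← Category.assoc (splitHom hF P (hij.trans hjk) hkl).iso.hom, splitHom_fst,
      ← Category.assoc, TwoSpan.whiskerRight_fst, Category.assoc, splitHom_snd]
  · simp only [TwoSpan.comp_iso_hom, Category.assoc]
    rw [← Category.assoc (splitHom hF P hij (hjk.trans hkl)).iso.hom,
      splitHom_snd hF hij (hjk.trans hkl),
      ← Category.assoc (spanOf F P hij ◁ splitHom hF P hjk hkl).iso.hom, TwoSpan.whiskerLeft_snd,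
      Category.assoc, splitHom_snd, TwoSpan.associator_snd_snd, c₃, splitHom_snd,
      TwoSpan.whiskerRight_snd]

/-- The cell of the nerve given by a functor with the pullback property. -/
noncomputable def NerveCell.ofFunctor (P : PullbackChoice C) : NerveCell (TwoSpan P) n where
  X i := ⟨F.obj (toDual (interval (le_refl i)))⟩
  f hij := spanOf F P hij
  θ hij hjk := splitHom hF P hij hjk
  f_self i := SpanDiagram.ext_of_eqToHom rfl
    ((map_incl_self F _ _).trans (Category.comp_id _).symm)
    ((map_incl_self F _ _).trans (Category.comp_id _).symm)
  θ_self_left {i j} hij := by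
    refine TwoSpan.hom₂_ext ?_
    -- An identity, written as `F` of the inclusion of `[i,j]` in itself, is inserted so that
    -- `splitHom_snd` applies.
    refine (Category.comp_id _).symm.trans ((congrArg _ (map_incl_self F _ le_rfl).symm).trans ?_)
    refine (splitHom_snd hF (le_refl i) hij).trans ?_
    exact (TwoSpan.whiskerRight_snd _ _).symm
  θ_self_right {i j} hij := by
    refine TwoSpan.hom₂_ext ?_
    refine (Category.comp_id _).symm.trans ((congrArg _ (map_incl_self F _ le_rfl).symm).trans ?_)
    refine (splitHom_fst hF hij (le_refl j)).trans ?_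
    exact (TwoSpan.whiskerLeft_fst _ _).symm
  compatibility := splitHom_cocycle hF

lemma NerveCell.toFunctor_ofFunctor : (NerveCell.ofFunctor hF P).toFunctor = F := by
  have h₁ {i j k : Fin (n + 1)} (hij : i ≤ j) (hjk : j ≤ k) :
      (NerveCell.ofFunctor hF P).proj₁ hij hjk =
        F.map (incl (I := interval hij) (U := interval (hij.trans hjk)) ⟨le_rfl, hjk⟩) :=
    IsPullback.isoIsPullback_inv_fst ..
  have h₂ {i j k : Fin (n + 1)} (hij : i ≤ j) (hjk : j ≤ k) :
      (NerveCell.ofFunctor hF P).proj₂ hij hjk =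
        F.map (incl (I := interval hjk) (U := interval (hij.trans hjk)) ⟨hij, le_rfl⟩) :=
    IsPullback.isoIsPullback_inv_snd ..
  refine CategoryTheory.Functor.ext (fun _ => rfl) fun I J f => ?_
  refine (congrArg₂ _ (h₁ _ _) (h₂ _ _)).trans ?_
  refine (map_incl_comp F _ _).trans ?_
  exact ((Category.id_comp _).trans (Category.comp_id _)).symm

end OfFunctor

/-- The nerve of the bicategory of spans is isomorphic to the simplicial set of spans. -/
noncomputable def nerveIso (P : PullbackChoice C) : bicategoryNerve (TwoSpan P) ≅ SpanSSet C :=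
  NatIso.ofComponents
    (fun n => Equiv.toIso (Equiv.ofBijective
      (fun x : NerveCell (TwoSpan P) n.unop.len =>
        (⟨x.toFunctor, x.pullbackProperty_toFunctor⟩ :
          { F : IntervalPoset n.unop.len ⥤ C // PullbackProperty F }))
      ⟨fun _ _ h => NerveCell.toFunctor_injective (congrArg Subtype.val h),
        fun F => ⟨NerveCell.ofFunctor F.2 P, Subtype.ext (NerveCell.toFunctor_ofFunctor F.2)⟩⟩))
    -- Simplicial operators merely reindex on both sides, so naturality is definitional.
    (fun _ => rfl)

end NerveIso

end SpanNerve

theorem mainTheorem6 {C : Type u} [Category.{v} C] [HasPullbacks C] :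
    (∀ P : SpanNerve.PullbackChoice C,
      Nonempty (SpanNerve.bicategoryNerve (SpanNerve.TwoSpan P) ≅ SpanNerve.SpanSSet C)) ∧
    SpanNerve.IsNOneCategory 2 (SpanNerve.SpanSSet C) ∧
    SSet.Quasicategory (SpanNerve.SpanSSet C) :=
  ⟨fun P => ⟨SpanNerve.nerveIso P⟩, SpanNerve.isNOneCategory_spanSSet,
    SpanNerve.isNOneCategory_spanSSet.quasicategory⟩
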